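/- Let $X$ be a connected complex manifold (Hausdorff, second countable, of finite dimension). A holomorphic vector field $\theta$ on $X$ is called completely integrable if for every $x\in X$ the initial value problem $\frac{d}{dt}\varphi(x,t)=\theta(\varphi(x,t))$, $\varphi(x,0)=x$ has a solution defined for all complex times $t\in\mathbb{C}$. The manifold $X$ is called holomorphically flexible if for every $x\in X$ the tangent space $T_xX$ is spanned over $\mathbb{C}$ by the values $\theta(x)$ of completely integrable holomorphic vector fields $\theta$ on $X$. Let $\mathrm{Aut}_{hol}(X)$ be the group of holomorphic automorphisms of $X$, and let $\mathrm{SAut}_{hol}(X)\subseteq \mathrm{Aut}_{hol}(X)$ be the subgroup generated by all holomorphic one-parameter subgroups, i.e. by the time-$t$ maps $x\mapsto\varphi(x,t)$, $t\in\mathbb{C}$, of the flows of completely integrable holomorphic vector fields. Then $\mathrm{SAut}_{hol}(X)$ acts transitively on $X$ if and only if $X$ is holomorphically flexible. In particular, if $X$ is holomorphically flexible, then $\mathrm{Aut}_{hol}(X)$ acts transitively on $X$. -/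

import Mathlib

open scoped Manifold ContDiff

/-- A vector field on the complex manifold `X` (modelled on the complex vector space `E`) is
holomorphic if it is a holomorphic (complex analytic) section of the tangent bundle. -/
def IsHolomorphicVectorField (E : Type*) [NormedAddCommGroup E] [NormedSpace ℂ E]
    {X : Type*} [TopologicalSpace X] [ChartedSpace E X] [IsManifold 𝓘(ℂ, E) ω X]
    (v : (x : X) → TangentSpace 𝓘(ℂ, E) x) : Prop :=
  ContMDiff 𝓘(ℂ, E) 𝓘(ℂ, E).tangent ω
    (fun x => (⟨x, v x⟩ : TangentBundle 𝓘(ℂ, E) X))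

/-- `φ` solves `d/dt φ(x,t) = v(φ(x,t))`, `φ(x,0) = x` for all starting points `x ∈ X` and all
complex times `t` (the derivative is the complex derivative in `t`). -/
def IsComplexFlow (E : Type*) [NormedAddCommGroup E] [NormedSpace ℂ E]
    {X : Type*} [TopologicalSpace X] [ChartedSpace E X]
    (v : (x : X) → TangentSpace 𝓘(ℂ, E) x) (φ : X → ℂ → X) : Prop :=
  ∀ x : X, φ x 0 = x ∧
    ∀ t : ℂ, HasMFDerivAt 𝓘(ℂ, ℂ) 𝓘(ℂ, E) (φ x) t
      ((1 : ℂ →L[ℂ] ℂ).smulRight (v (φ x t)))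

/-- A completely integrable holomorphic vector field: a holomorphic vector field whose integral
curves exist for all complex times and all starting points. -/
def IsCompletelyIntegrable (E : Type*) [NormedAddCommGroup E] [NormedSpace ℂ E]
    {X : Type*} [TopologicalSpace X] [ChartedSpace E X] [IsManifold 𝓘(ℂ, E) ω X]
    (v : (x : X) → TangentSpace 𝓘(ℂ, E) x) : Prop :=
  IsHolomorphicVectorField E v ∧ ∃ φ : X → ℂ → X, IsComplexFlow E v φ

/-- The point `x` is holomorphically flexible: the values at `x` of the completely integrable
holomorphic vector fields on `X` span the tangent space at `x` over `ℂ`. -/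
def IsHolomorphicallyFlexibleAt (E : Type*) [NormedAddCommGroup E] [NormedSpace ℂ E]
    {X : Type*} [TopologicalSpace X] [ChartedSpace E X] [IsManifold 𝓘(ℂ, E) ω X]
    (x : X) : Prop :=
  Submodule.span ℂ {w : TangentSpace 𝓘(ℂ, E) x |
    ∃ v : (y : X) → TangentSpace 𝓘(ℂ, E) y, IsCompletelyIntegrable E v ∧ v x = w} = ⊤

/-- The complex manifold `X` is holomorphically flexible: every point is. -/
def IsHolomorphicallyFlexible (E : Type*) [NormedAddCommGroup E] [NormedSpace ℂ E]
    (X : Type*) [TopologicalSpace X] [ChartedSpace E X] [IsManifold 𝓘(ℂ, E) ω X] : Prop :=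
  ∀ x : X, IsHolomorphicallyFlexibleAt E x

/-- The group `Aut_hol(X)` of holomorphic automorphisms (biholomorphic self-maps) of `X`, as a
group of permutations of `X`; in particular it acts on `X`. -/
def AutHol (E : Type*) [NormedAddCommGroup E] [NormedSpace ℂ E]
    (X : Type*) [TopologicalSpace X] [ChartedSpace E X] : Subgroup (Equiv.Perm X) where
  carrier := {f | ContMDiff 𝓘(ℂ, E) 𝓘(ℂ, E) ω f ∧ ContMDiff 𝓘(ℂ, E) 𝓘(ℂ, E) ω f.symm}
  mul_mem' := fun hf hg => ⟨hf.1.comp hg.1, hg.2.comp hf.2⟩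
  one_mem' := ⟨contMDiff_id, contMDiff_id⟩
  inv_mem' := fun hf => ⟨hf.2, hf.1⟩

/-- The subgroup of `Aut_hol(X)` generated by the holomorphic one-parameter subgroups, that is, by
the time-`t` maps (`t ∈ ℂ`) of the flows of completely integrable holomorphic vector fields. -/
def SAutHol (E : Type*) [NormedAddCommGroup E] [NormedSpace ℂ E]
    (X : Type*) [TopologicalSpace X] [ChartedSpace E X] [IsManifold 𝓘(ℂ, E) ω X] :
    Subgroup (AutHol E X) :=
  Subgroup.closure {g | ∃ v : (x : X) → TangentSpace 𝓘(ℂ, E) x, IsHolomorphicVectorField E v ∧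
    ∃ φ : X → ℂ → X, IsComplexFlow E v φ ∧ ∃ t : ℂ, ∀ x : X, g • x = φ x t}

/-! Let D_x be the span in T_xX of the values of complete fields (`completeSpan`). Flows of complete
fields are jointly holomorphic (`IsComplexFlow.contMDiff`). So if v_1(x), ..., v_n(x) is a basis of
D_x and W a complement of D_x, then composing the flows for times t_1, ..., t_n, started on a slice
in the direction of W, gives local coordinates (t, w) at x (`exists_inverse_flowBox`).

If X is flexible, then W = 0 and the flow box fills a neighbourhood of x inside the orbit of x.
Hence all orbits are open, and connectedness leaves only one.

Conversely, automorphisms push complete fields forward to complete fields, hence preserve D, and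
transitivity makes its rank constant. The t-directions of a flow box are tangent to D and, by
equality of ranks, exhaust it; so w is constant along D. This yields foliated charts without Lie
brackets or Frobenius (`exists_isFoliatedChart`). If the rank were less than dim X, w would take
uncountably many values in a box. But countably many plaques (level sets of w), chained from one
point, form a set invariant under all flows, which is X by transitivity; and each plaque meets only
countably many levels of any chart (`IsFoliatedChart.countable_image_of_isPretransitive`), a
contradiction. -/

open scoped Topology
open Set Filter

/-! ### Composition operators on spaces of continuous functions -/

section Nemytskii

variable {K : Type*} [TopologicalSpace K] [CompactSpace K]
  {E : Type*} [NormedAddCommGroup E] [NormedSpace ℂ E]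
  {F : Type*} [NormedAddCommGroup F] [NormedSpace ℂ F]

/-- A continuous multilinear map acts pointwise on continuous functions. -/
noncomputable def ContinuousMultilinearMap.onContinuousMap {n : ℕ}
    (p : ContinuousMultilinearMap ℂ (fun _ : Fin n => E) F) :
    ContinuousMultilinearMap ℂ (fun _ : Fin n => C(K, E)) C(K, F) :=
  MultilinearMap.mkContinuous
    { toFun := fun m => ⟨fun k => p fun i => m i k, by fun_prop⟩
      map_update_add' := by
        intro _ m i x y
        ext k
        have h (z : C(K, E)) : (fun j => Function.update m i z j k)
            = Function.update (fun j => m j k) i (z k) := by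
          ext j; by_cases hj : j = i
          · subst hj; simp
          · simp [hj]
        convert p.map_update_add (fun j => m j k) i (x k) (y k) using 1
        · simp [h]
        · simp [h]
      map_update_smul' := by
        intro _ m i c x
        ext k
        have h (z : C(K, E)) : (fun j => Function.update m i z j k)
            = Function.update (fun j => m j k) i (z k) := by
          ext j; by_cases hj : j = i
          · subst hj; simp
          · simp [hj]
        convert p.map_update_smul (fun j => m j k) i c (x k) using 1
        · simp [h]
        · simp [h] }
    ‖p‖ (by
      intro m
      rw [ContinuousMap.norm_le _ (by positivity)]
      intro k
      refine (p.le_opNorm _).trans ?_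
      gcongr with i
      exact (m i).norm_coe_le_norm k)

theorem ContinuousMultilinearMap.norm_onContinuousMap_le {n : ℕ}
    (p : ContinuousMultilinearMap ℂ (fun _ : Fin n => E) F) :
    ‖(p.onContinuousMap : ContinuousMultilinearMap ℂ (fun _ : Fin n => C(K, E)) C(K, F))‖ ≤ ‖p‖ :=
  MultilinearMap.mkContinuous_norm_le _ (norm_nonneg _) _

/-- Composition with an analytic function is an analytic operation on continuous functions, near a
constant function. -/
theorem AnalyticAt.exists_analyticAt_onContinuousMap [CompleteSpace F] {f : E → F} {x₀ : E}
    (hf : AnalyticAt ℂ f x₀) :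
    ∃ N : C(K, E) → C(K, F), AnalyticAt ℂ N 0 ∧
      ∀ᶠ h in 𝓝 (0 : C(K, E)), ∀ k, N h k = f (x₀ + h k) := by
  obtain ⟨p, r, hp⟩ := hf
  let P : FormalMultilinearSeries ℂ C(K, E) C(K, F) := fun n => (p n).onContinuousMap
  -- Acting pointwise does not increase the norms of the coefficients, so the radius of convergence
  -- does not shrink.
  have hr : p.radius ≤ P.radius := by
    refine ENNReal.le_of_forall_nnreal_lt fun s hs => ?_
    obtain ⟨C, -, hC⟩ := p.norm_mul_pow_le_of_lt_radius hs
    refine P.le_radius_of_bound C fun n => le_trans ?_ (hC n)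
    gcongr
    exact (p n).norm_onContinuousMap_le
  have hP := P.hasFPowerSeriesOnBall (hp.radius_pos.trans_le hr)
  refine ⟨P.sum, hP.analyticAt, ?_⟩
  have hpos : 0 < min r P.radius := lt_min hp.r_pos hP.r_pos
  filter_upwards [Metric.eball_mem_nhds (0 : C(K, E)) hpos] with h hh k
  have hh1 : h ∈ Metric.eball (0 : C(K, E)) P.radius :=
    Metric.eball_subset_eball (min_le_right _ _) hh
  have hh2 : h k ∈ Metric.eball (0 : E) r := by
    have h1 : h ∈ Metric.eball (0 : C(K, E)) r := Metric.eball_subset_eball (min_le_left _ _) hh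
    rw [Metric.mem_eball, edist_zero_right] at h1 ⊢
    refine lt_of_le_of_lt ?_ h1
    exact enorm_le_iff_norm_le.2 (h.norm_coe_le_norm k)
  have h1 := (hP.hasSum hh1).map (ContinuousMap.evalCLM ℂ k : C(K, F) →L[ℂ] F)
    (ContinuousMap.evalCLM ℂ k).continuous
  rw [zero_add] at h1
  exact h1.unique (hp.hasSum hh2)

end Nemytskii

/-! ### Integration of curves on the unit interval -/

section Primitive

variable {E : Type*} [NormedAddCommGroup E] [NormedSpace ℂ E]

/-- The primitive vanishing at `0`, as an operator on continuous functions on the unit interval. -/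
noncomputable def unitInterval.primitive (E : Type*) [NormedAddCommGroup E] [NormedSpace ℂ E] :
    C(unitInterval, E) →L[ℂ] C(unitInterval, E) :=
  LinearMap.mkContinuous
    -- `projIcc` extends the curve to ℝ by constants, so that interval integrals apply.
    { toFun := fun h => ⟨fun τ => ∫ σ in (0 : ℝ)..τ, h (projIcc 0 1 zero_le_one σ), by
        have : Continuous fun σ : ℝ => h (projIcc 0 1 zero_le_one σ) :=
          h.continuous.comp continuous_projIcc
        exact (intervalIntegral.continuous_primitive
          (fun a b => this.intervalIntegrable a b) 0).comp continuous_subtype_val⟩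
      map_add' := by
        intro g h
        ext τ
        exact intervalIntegral.integral_add
          ((g.continuous.comp continuous_projIcc).intervalIntegrable _ _)
          ((h.continuous.comp continuous_projIcc).intervalIntegrable _ _)
      map_smul' := by
        intro c h
        ext τ
        exact intervalIntegral.integral_smul c _ }
    1 (by
      intro h
      rw [ContinuousMap.norm_le _ (by positivity)]
      intro τ
      refine (intervalIntegral.norm_integral_le_of_norm_le_const
        (fun σ _ => h.norm_coe_le_norm _)).trans ?_
      rw [sub_zero, abs_of_nonneg τ.2.1, mul_comm]
      gcongr
      exact τ.2.2)

theorem unitInterval.primitive_apply (h : C(unitInterval, E)) (τ : unitInterval) :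
    unitInterval.primitive E h τ = ∫ σ in (0 : ℝ)..τ, h (projIcc 0 1 zero_le_one σ) := rfl

end Primitive

/-! ### Analytic dependence of solutions via the implicit function theorem -/

section AnalyticDependence

variable {E : Type*} [NormedAddCommGroup E] [NormedSpace ℂ E] [CompleteSpace E]

/-- The solutions of `γ' = t f(γ)`, `γ(0) = x` on the unit interval depend analytically on `(x, t)`
near `(x₀, 0)`, as elements of the Banach space of continuous curves. -/
theorem AnalyticAt.exists_analytic_solution {f : E → E} {x₀ : E} (hf : AnalyticAt ℂ f x₀) :
    ∃ Γ : E × ℂ → C(unitInterval, E), ContDiffAt ℂ ω Γ (x₀, 0) ∧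
      Γ (x₀, 0) = ContinuousMap.const unitInterval x₀ ∧
      ∀ᶠ p in 𝓝 (x₀, (0 : ℂ)), ∀ τ : unitInterval,
        Γ p τ = p.1 + p.2 • ∫ σ in (0 : ℝ)..τ, f (Γ p (projIcc 0 1 zero_le_one σ)) := by
  obtain ⟨N, hN, hNf⟩ := hf.exists_analyticAt_onContinuousMap (K := unitInterval)
  let c : E →L[ℂ] C(unitInterval, E) := ContinuousLinearMap.const ℂ unitInterval
  -- The unknown is h = γ - x₀, and S = 0 is the integral equation for γ. At (x₀, 0) the map h ↦ S
  -- is the identity, so the partial derivative is invertible.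
  let S : (E × ℂ) × C(unitInterval, E) → C(unitInterval, E) := fun q =>
    q.2 - c (q.1.1 - x₀) - q.1.2 • unitInterval.primitive E (N q.2)
  have hN' : ContDiffAt ℂ ω N 0 := hN.contDiffAt
  have hS : ContDiffAt ℂ ω S ((x₀, 0), 0) := by
    have : ContDiffAt ℂ ω (fun q : (E × ℂ) × C(unitInterval, E) => N q.2) ((x₀, 0), 0) :=
      ContDiffAt.comp _ hN' contDiffAt_snd
    refine (contDiffAt_snd.sub (c.contDiff.contDiffAt.comp _
      (contDiffAt_fst.fst.sub contDiffAt_const))).sub ?_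
    exact contDiffAt_fst.snd.smul
      ((unitInterval.primitive E).contDiff.contDiffAt.comp _ this)
  have hS0 : S ((x₀, 0), 0) = 0 := by simp [S]
  have hinv : fderiv ℂ S ((x₀, 0), 0) ∘L .inr ℂ (E × ℂ) C(unitInterval, E) = .id ℂ _ := by
    have h1 : HasFDerivAt
        (fun h : C(unitInterval, E) => (((x₀, 0), h) : (E × ℂ) × C(unitInterval, E)))
        (.inr ℂ (E × ℂ) C(unitInterval, E)) 0 := hasFDerivAt_prodMk_right _ _
    have h2 := (hS.differentiableAt (by simp)).hasFDerivAt.comp (0 : C(unitInterval, E)) h1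
    refine h2.unique ?_
    have : S ∘ (fun h : C(unitInterval, E) => (((x₀, 0), h) : (E × ℂ) × C(unitInterval, E)))
        = id := by
      ext h : 1; simp [S]
    rw [this]
    exact hasFDerivAt_id _
  have hi : (fderiv ℂ S ((x₀, 0), 0) ∘L .inr ℂ (E × ℂ) C(unitInterval, E)).IsInvertible := by
    rw [hinv]; exact ⟨.refl ℂ _, rfl⟩
  let g := hS.implicitFunction (by simp) hi
  have hg : ContDiffAt ℂ ω g (x₀, 0) := hS.contDiffAt_implicitFunction (by simp) hi
  have hg0 : g (x₀, 0) = 0 := hS.implicitFunction_apply_self (by simp) hi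
  refine ⟨fun p => c x₀ + g p, contDiffAt_const.add hg, ?_, ?_⟩
  · simp only [hg0, add_zero]; rfl
  · have h1 : Tendsto g (𝓝 (x₀, 0)) (𝓝 0) := by
      have := hg.continuousAt.tendsto; rwa [hg0] at this
    filter_upwards [hS.eventually_apply_implicitFunction (by simp) hi, h1.eventually hNf]
      with p hp hpN τ
    rw [hS0] at hp
    have h2 : g p = c (p.1 - x₀) + p.2 • unitInterval.primitive E (N (g p)) := by
      have : g p - c (p.1 - x₀) - p.2 • unitInterval.primitive E (N (g p)) = 0 := hp
      rw [sub_sub, sub_eq_zero] at this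
      exact this
    have h3 : g p τ = (p.1 - x₀) + p.2 • unitInterval.primitive E (N (g p)) τ := by
      conv_lhs => rw [h2]
      rfl
    have h4 : (c x₀ + g p) τ = x₀ + g p τ := rfl
    rw [h4, h3, unitInterval.primitive_apply]
    simp only [hpN]
    rw [← add_assoc, add_sub_cancel]
    rfl

end AnalyticDependence

/-! ### The local holomorphic flow -/

section LocalFlow

variable {E : Type*} [NormedAddCommGroup E] [NormedSpace ℂ E]
  {X : Type*} [TopologicalSpace X] [ChartedSpace E X]

/-- The complex curve `u` is an integral curve of `v`, defined for all complex times. -/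
def IsComplexIntegralCurve (E : Type*) [NormedAddCommGroup E] [NormedSpace ℂ E]
    {X : Type*} [TopologicalSpace X] [ChartedSpace E X]
    (v : (x : X) → TangentSpace 𝓘(ℂ, E) x) (u : ℂ → X) : Prop :=
  ∀ t : ℂ, HasMFDerivAt 𝓘(ℂ, ℂ) 𝓘(ℂ, E) u t ((1 : ℂ →L[ℂ] ℂ).smulRight (v (u t)))

theorem IsComplexIntegralCurve.continuous {v : (x : X) → TangentSpace 𝓘(ℂ, E) x}
    {u : ℂ → X} (hu : IsComplexIntegralCurve E v u) : Continuous u :=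
  continuous_iff_continuousAt.2 fun t => (hu t).continuousAt

variable [IsManifold 𝓘(ℂ, E) ω X]

/-- The expression of a vector field in the preferred chart at `x₀`. -/
noncomputable def chartField (v : (x : X) → TangentSpace 𝓘(ℂ, E) x) (x₀ : X) : E → E :=
  haveI : IsManifold 𝓘(ℂ, E) 1 X := .of_le (n := ω) le_top
  fun z => tangentCoordChange 𝓘(ℂ, E) ((extChartAt 𝓘(ℂ, E) x₀).symm z) x₀
    ((extChartAt 𝓘(ℂ, E) x₀).symm z) (v ((extChartAt 𝓘(ℂ, E) x₀).symm z))

theorem IsHolomorphicVectorField.contDiffAt_chartField {v : (x : X) → TangentSpace 𝓘(ℂ, E) x}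
    (hv : IsHolomorphicVectorField E v) (x₀ : X) :
    ContDiffAt ℂ ω (chartField v x₀) (extChartAt 𝓘(ℂ, E) x₀ x₀) := by
  have h := (contMDiffAt_iff.1 (hv x₀)).2
  exact (h.contDiffAt (by simp)).snd

/-- The derivative of the chart at `u t` is the tangent coordinate change built into `chartField`,
so the chain rule gives an ordinary differential equation in E. -/
theorem IsComplexIntegralCurve.hasDerivAt_extChartAt {v : (x : X) → TangentSpace 𝓘(ℂ, E) x}
    {u : ℂ → X} (hu : IsComplexIntegralCurve E v u) {x₀ : X} {t : ℂ}
    (ht : u t ∈ (extChartAt 𝓘(ℂ, E) x₀).source) :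
    HasDerivAt (extChartAt 𝓘(ℂ, E) x₀ ∘ u) (chartField v x₀ (extChartAt 𝓘(ℂ, E) x₀ (u t))) t := by
  have : IsManifold 𝓘(ℂ, E) 1 X := .of_le (n := ω) le_top
  have hsrc : u t ∈ (chartAt E x₀).source := by rwa [extChartAt_source] at ht
  rw [chartField, PartialEquiv.left_inv _ ht]
  have h1 := HasMFDerivAt.comp t (hasMFDerivAt_extChartAt (I := 𝓘(ℂ, E)) hsrc) (hu t)
  rw [mfderiv_chartAt_eq_tangentCoordChange hsrc] at h1
  let L : E →L[ℂ] E := tangentCoordChange 𝓘(ℂ, E) (u t) x₀ (u t)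
  let w : E := v (u t)
  have h2 : HasFDerivAt (extChartAt 𝓘(ℂ, E) x₀ ∘ u)
      (L ∘L (1 : ℂ →L[ℂ] ℂ).smulRight w) t := h1.hasFDerivAt
  refine h2.hasDerivAt.congr_deriv ?_
  change L ((1 : ℂ) • w) = L w
  rw [one_smul]

/-- A curve `γ` on the unit interval that satisfies the integral equation of `γ' = t f(γ)`
satisfies the differential equation. -/
theorem hasDerivWithinAt_of_integral_equation {f : E → E} [CompleteSpace E] {x : E} {t : ℂ}
    {γ : C(unitInterval, E)} (hf : ∀ τ, ContinuousAt f (γ τ))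
    (hγ : ∀ τ : unitInterval, γ τ = x + t • ∫ σ in (0 : ℝ)..τ, f (γ (projIcc 0 1 zero_le_one σ)))
    {τ : ℝ} (hτ : τ ∈ Ico (0 : ℝ) 1) :
    HasDerivWithinAt (fun σ => γ (projIcc 0 1 zero_le_one σ))
      (t • f (γ (projIcc 0 1 zero_le_one τ))) (Ici τ) τ := by
  have hc : Continuous fun σ : ℝ => f (γ (projIcc 0 1 zero_le_one σ)) := by
    refine continuous_iff_continuousAt.2 fun σ => ?_
    exact ContinuousAt.comp (f := fun σ : ℝ => γ (projIcc 0 1 zero_le_one σ)) (hf _)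
      (γ.continuous.comp continuous_projIcc).continuousAt
  have h1 : HasDerivAt (fun s : ℝ => x + t • ∫ σ in (0 : ℝ)..s, f (γ (projIcc 0 1 zero_le_one σ)))
      (t • f (γ (projIcc 0 1 zero_le_one τ))) τ :=
    ((hc.integral_hasStrictDerivAt 0 τ).hasDerivAt.const_smul t).const_add x
  -- The integral equation holds only on [0, 1]: at τ = 0 just the right derivative is available,
  -- and τ < 1 leaves room on the right.
  refine h1.hasDerivWithinAt.congr_of_eventuallyEq_of_mem ?_ self_mem_Ici
  filter_upwards [Icc_mem_nhdsGE hτ.2] with s hs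
  have hs' : s ∈ Icc (0 : ℝ) 1 := ⟨hτ.1.trans hs.1, hs.2⟩
  rw [hγ, projIcc_of_mem zero_le_one hs']

/-- Near `(x₀, 0)`, the complex integral curves of a holomorphic vector field are given by a
holomorphic local flow. -/
theorem IsHolomorphicVectorField.exists_local_flow [CompleteSpace E] [T2Space X]
    {v : (x : X) → TangentSpace 𝓘(ℂ, E) x} (hv : IsHolomorphicVectorField E v) (x₀ : X) :
    ∃ Ψ : X × ℂ → X, ContMDiffAt (𝓘(ℂ, E).prod 𝓘(ℂ, ℂ)) 𝓘(ℂ, E) ω Ψ (x₀, 0) ∧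
      ∀ᶠ p in 𝓝 (x₀, (0 : ℂ)), ∀ u : ℂ → X, IsComplexIntegralCurve E v u → u 0 = p.1 →
        u p.2 = Ψ p := by
  set e := extChartAt 𝓘(ℂ, E) x₀ with he
  set f := chartField v x₀ with hf_def
  have hf : ContDiffAt ℂ ω f (e x₀) := hv.contDiffAt_chartField x₀
  obtain ⟨Γ, hΓ, hΓ0, hΓeq⟩ := hf.analyticAt.exists_analytic_solution
  obtain ⟨K, s, hs, hK⟩ := (hf.of_le le_top : ContDiffAt ℂ 1 f (e x₀)).exists_lipschitzOnWith
  have htarget : e.target ∈ 𝓝 (e x₀) := extChartAt_target_mem_nhds x₀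
  obtain ⟨δ, hδ, hball⟩ := Metric.mem_nhds_iff.1 (inter_mem hs htarget)
  have hball_cont : ∀ z ∈ Metric.ball (e x₀) δ, ContinuousAt f z := fun z hz =>
    (hK.continuousOn.mono (hball.trans inter_subset_left)).continuousAt
      (Metric.isOpen_ball.mem_nhds hz)
  have hepair : ContMDiffAt (𝓘(ℂ, E).prod 𝓘(ℂ, ℂ)) (𝓘(ℂ, E).prod 𝓘(ℂ, ℂ)) ω
      (fun p : X × ℂ => (e p.1, p.2)) (x₀, 0) :=
    (contMDiffAt_extChartAt.comp (x₀, (0 : ℂ)) contMDiffAt_fst).prodMk contMDiffAt_snd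
  -- The parameter τ rescales complex time: γ(τ) stands for u(τt), so u(t) is read off at τ = 1.
  refine ⟨fun p => e.symm (Γ (e p.1, p.2) 1), ?_, ?_⟩
  · have h1 : ContDiffAt ℂ ω (fun q => Γ q 1) (e x₀, (0 : ℂ)) :=
      (ContinuousMap.evalCLM ℂ (1 : unitInterval) :
        C(unitInterval, E) →L[ℂ] E).contDiff.contDiffAt.comp _ hΓ
    have h2 : ContMDiffAt (𝓘(ℂ, E).prod 𝓘(ℂ, ℂ)) 𝓘(ℂ, E) ω (fun q => Γ q 1) (e x₀, (0 : ℂ)) := by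
      rw [← modelWithCornersSelf_prod, chartedSpaceSelf_prod]
      exact h1.contMDiffAt
    have h3 : ContMDiffAt 𝓘(ℂ, E) 𝓘(ℂ, E) ω e.symm (Γ (e x₀, 0) 1) := by
      rw [hΓ0]
      exact (contMDiffOn_extChartAt_symm x₀).contMDiffAt htarget
    exact h3.comp (x₀, (0 : ℂ)) (ContMDiffAt.comp (x₀, (0 : ℂ)) h2 hepair)
  have hnear : ∀ᶠ q in 𝓝 (e x₀, (0 : ℂ)), ∀ τ, Γ q τ ∈ Metric.ball (e x₀) δ := by
    have := hΓ.continuousAt.tendsto.eventually (Metric.ball_mem_nhds _ hδ)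
    filter_upwards [this] with q hq τ
    rw [hΓ0] at hq
    exact (ContinuousMap.dist_apply_le_dist τ).trans_lt hq
  have htend : Tendsto (fun p : X × ℂ => (e p.1, p.2)) (𝓝 (x₀, 0)) (𝓝 (e x₀, 0)) :=
    hepair.continuousAt
  filter_upwards [htend.eventually hnear, htend.eventually hΓeq,
    continuousAt_fst.preimage_mem_nhds (x := (x₀, (0 : ℂ)))
      (extChartAt_source_mem_nhds (I := 𝓘(ℂ, E)) x₀)] with p hp hpeq hpsrc u hu hu0
  obtain ⟨x, t⟩ := p
  simp only at hp hpeq hu0 ⊢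
  have hxsrc : x ∈ e.source := hpsrc
  set γ := Γ (e x, t) with hγ
  let c : ℝ → E := fun τ => γ (projIcc 0 1 zero_le_one τ)
  have hc : Continuous c := γ.continuous.comp continuous_projIcc
  have hcball : ∀ τ, c τ ∈ Metric.ball (e x₀) δ := fun τ => hp _
  have hline : Continuous fun τ : ℝ => (τ : ℂ) * t := by fun_prop
  have hul : Continuous fun τ : ℝ => u (τ * t) := hu.continuous.comp hline
  -- Nothing keeps u in the chart a priori. Agreement is propagated along the segment: it is a
  -- closed condition, and wherever it holds u is in the chart, so uniqueness for Lipschitz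
  -- equations extends it to the right.
  have hsub : Icc (0 : ℝ) 1 ⊆ {τ : ℝ | u (τ * t) = e.symm (c τ)} := by
    refine IsClosed.Icc_subset_of_forall_mem_nhdsWithin ?_ ?_ ?_
    · refine IsClosed.inter (isClosed_eq hul ?_) isClosed_Icc
      exact (continuousOn_extChartAt_symm x₀).comp_continuous hc fun τ => (hball (hcball τ)).2
    · have h0 : c 0 = e x := by
        change γ (projIcc 0 1 zero_le_one 0) = e x
        rw [hpeq]; simp
      simp [h0, hu0, e.left_inv hxsrc]
    · rintro τ₀ ⟨h₀, hτ₀⟩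
      have h₀' : u (τ₀ * t) = e.symm (c τ₀) := h₀
      have hc₀ := hball (hcball τ₀)
      have hsrc₀ : u (τ₀ * t) ∈ e.source := h₀' ▸ e.map_target hc₀.2
      have heu₀ : e (u (τ₀ * t)) = c τ₀ := by rw [h₀', e.right_inv hc₀.2]
      have hev1 : ∀ᶠ τ : ℝ in 𝓝 τ₀, u (τ * t) ∈ e.source :=
        hul.continuousAt.eventually (extChartAt_source_mem_nhds' hsrc₀)
      have hev2 : ∀ᶠ τ : ℝ in 𝓝 τ₀, e (u (τ * t)) ∈ Metric.ball (e x₀) δ := by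
        have : ContinuousAt (fun τ : ℝ => e (u (τ * t))) τ₀ :=
          ContinuousAt.comp (f := fun τ : ℝ => u (τ * t))
            (continuousAt_extChartAt' hsrc₀) hul.continuousAt
        refine this.eventually (Metric.isOpen_ball.mem_nhds ?_)
        change e (u (τ₀ * t)) ∈ _
        rw [heu₀]; exact hcball τ₀
      obtain ⟨ε, hε, hεball⟩ := Metric.eventually_nhds_iff.1 (hev1.and hev2)
      -- The cap 1 is where the equation for γ ends; ε / 2 keeps the closed interval inside the open
      -- ε-ball.
      set b := min 1 (τ₀ + ε / 2) with hb
      have hτb : τ₀ < b := lt_min hτ₀.2 (by linarith)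
      have hin : ∀ τ ∈ Icc τ₀ b, u (τ * t) ∈ e.source ∧ e (u (τ * t)) ∈ Metric.ball (e x₀) δ := by
        intro τ hτ
        refine hεball ?_
        rw [Real.dist_eq, abs_of_nonneg (sub_nonneg.2 hτ.1)]
        have := hτ.2.trans (min_le_right _ _)
        linarith
      have hder : ∀ τ ∈ Icc τ₀ b,
          HasDerivAt (fun τ : ℝ => e (u (τ * t))) (t • f (e (u (τ * t)))) τ := by
        intro τ hτ
        have h1 := hu.hasDerivAt_extChartAt (hin τ hτ).1
        have h2 : HasDerivAt (fun τ : ℝ => (τ : ℂ) * t) t τ := by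
          simpa using (Complex.ofRealCLM.hasDerivAt (x := τ)).mul_const t
        exact HasDerivAt.scomp (𝕜 := ℝ) (𝕜' := ℂ) (h := fun τ : ℝ => (τ : ℂ) * t) τ h1 h2
      have heq : EqOn (fun τ : ℝ => e (u (τ * t))) c (Icc τ₀ b) := by
        refine ODE_solution_unique_of_mem_Icc_right (v := fun _ z => t • f z)
          (s := fun _ => Metric.ball (e x₀) δ) (K := ‖t‖₊ * K)
          ?_ ?_ ?_ ?_ hc.continuousOn ?_ ?_ heu₀
        · intro τ _
          exact (lipschitzWith_smul t).comp_lipschitzOnWith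
            (hK.mono (hball.trans inter_subset_left))
        · exact fun τ hτ => (hder τ hτ).continuousAt.continuousWithinAt
        · exact fun τ hτ => (hder τ (Ico_subset_Icc_self hτ)).hasDerivWithinAt
        · exact fun τ hτ => (hin τ (Ico_subset_Icc_self hτ)).2
        · intro τ hτ
          refine hasDerivWithinAt_of_integral_equation (x := e x)
            (fun τ => hball_cont _ (hp τ)) hpeq ⟨hτ₀.1.trans hτ.1, ?_⟩
          exact hτ.2.trans_le (min_le_left _ _)
        · exact fun τ _ => hcball τ
      filter_upwards [Icc_mem_nhdsGT hτb] with τ hτ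
      have h3 : e (u (τ * t)) = c τ := heq hτ
      change u (τ * t) = e.symm (c τ)
      rw [← h3, e.left_inv (hin τ hτ).1]
  have := hsub (right_mem_Icc.2 zero_le_one)
  simpa [c] using this

end LocalFlow

/-! ### Uniqueness, group law and holomorphy of complete flows -/

section GlobalFlow

variable {E : Type*} [NormedAddCommGroup E] [NormedSpace ℂ E]
  {X : Type*} [TopologicalSpace X] [ChartedSpace E X]
  {v : (x : X) → TangentSpace 𝓘(ℂ, E) x} {φ : X → ℂ → X}

theorem IsComplexIntegralCurve.comp_const_add {u : ℂ → X} (hu : IsComplexIntegralCurve E v u)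
    (s : ℂ) : IsComplexIntegralCurve E v fun t => u (s + t) := by
  intro t
  have h1 : HasMFDerivAt 𝓘(ℂ, ℂ) 𝓘(ℂ, ℂ) (fun t : ℂ => s + t) t (.id ℂ ℂ) :=
    ((hasFDerivAt_id t).const_add s).hasMFDerivAt
  exact HasMFDerivAt.comp t (hu (s + t)) h1

theorem IsComplexFlow.isComplexIntegralCurve (hφ : IsComplexFlow E v φ) (x : X) :
    IsComplexIntegralCurve E v (φ x) := (hφ x).2

theorem IsComplexFlow.apply_zero (hφ : IsComplexFlow E v φ) (x : X) : φ x 0 = x := (hφ x).1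

variable [IsManifold 𝓘(ℂ, E) ω X] [CompleteSpace E] [T2Space X]

/-- The agreement set is closed since X is Hausdorff, and open since near a common point both
translated curves follow the same local flow; ℂ is connected. -/
theorem IsComplexIntegralCurve.eq_of_apply_zero_eq (hv : IsHolomorphicVectorField E v)
    {u u' : ℂ → X} (hu : IsComplexIntegralCurve E v u) (hu' : IsComplexIntegralCurve E v u')
    (h0 : u 0 = u' 0) : u = u' := by
  have hclopen : IsClopen {t | u t = u' t} := by
    refine ⟨isClosed_eq hu.continuous hu'.continuous, isOpen_iff_mem_nhds.2 fun t₀ ht₀ => ?_⟩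
    obtain ⟨Ψ, -, hΨ⟩ := hv.exists_local_flow (u t₀)
    have htend : Tendsto (fun t : ℂ => (u t₀, t - t₀)) (𝓝 t₀) (𝓝 (u t₀, 0)) := by
      have : ContinuousAt (fun t : ℂ => (u t₀, t - t₀)) t₀ := by fun_prop
      simpa [ContinuousAt] using this
    filter_upwards [htend.eventually hΨ] with t ht
    have h1 := ht _ (hu.comp_const_add t₀) (by simp)
    have h2 := ht _ (hu'.comp_const_add t₀) (by simpa using ht₀.symm)
    simp only [add_sub_cancel] at h1 h2
    exact h1.trans h2.symm
  have huniv := hclopen.eq_univ ⟨0, h0⟩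
  funext t
  exact (huniv ▸ mem_univ t : t ∈ {t | u t = u' t})

theorem IsComplexFlow.apply_add (hv : IsHolomorphicVectorField E v) (hφ : IsComplexFlow E v φ)
    (x : X) (s t : ℂ) : φ x (s + t) = φ (φ x s) t :=
  congrFun (((hφ.isComplexIntegralCurve x).comp_const_add s).eq_of_apply_zero_eq hv
    (hφ.isComplexIntegralCurve (φ x s)) (by simp [hφ.apply_zero])) t

theorem IsComplexFlow.contMDiffAt_zero (hv : IsHolomorphicVectorField E v)
    (hφ : IsComplexFlow E v φ) (x : X) :
    ContMDiffAt (𝓘(ℂ, E).prod 𝓘(ℂ, ℂ)) 𝓘(ℂ, E) ω (fun p : X × ℂ => φ p.1 p.2) (x, 0) := by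
  obtain ⟨Ψ, hΨ, heq⟩ := hv.exists_local_flow x
  refine hΨ.congr_of_eventuallyEq ?_
  filter_upwards [heq] with p hp
  exact hp _ (hφ.isComplexIntegralCurve p.1) (hφ.apply_zero p.1)

/-- The flow of a completely integrable holomorphic vector field is jointly holomorphic. -/
theorem IsComplexFlow.contMDiff (hv : IsHolomorphicVectorField E v) (hφ : IsComplexFlow E v φ) :
    ContMDiff (𝓘(ℂ, E).prod 𝓘(ℂ, ℂ)) 𝓘(ℂ, E) ω (fun p : X × ℂ => φ p.1 p.2) := by
  rintro ⟨x, t⟩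
  let S : Set ℂ := {t | ContMDiffAt (𝓘(ℂ, E).prod 𝓘(ℂ, ℂ)) 𝓘(ℂ, E) ω
    (fun p : X × ℂ => φ p.1 p.2) (x, t)}
  -- Freezing the first or the second coordinate at t₀ turns this one statement into openness or
  -- closedness of S.
  have key : ∀ t₀ : ℂ, ∀ᶠ q in 𝓝 (t₀, t₀), q.1 ∈ S → q.2 ∈ S := by
    intro t₀
    have h1 := (contMDiffAt_iff_contMDiffAt_nhds (by simp)).1 (hφ.contMDiffAt_zero hv (φ x t₀))
    have h2 : Tendsto (fun q : ℂ × ℂ => (φ x q.1, q.2 - q.1)) (𝓝 (t₀, t₀)) (𝓝 (φ x t₀, 0)) := by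
      have : ContinuousAt (fun q : ℂ × ℂ => (φ x q.1, q.2 - q.1)) (t₀, t₀) :=
        (((hφ.isComplexIntegralCurve x).continuous.comp continuous_fst).prodMk
          (continuous_snd.sub continuous_fst)).continuousAt
      simpa [ContinuousAt] using this
    filter_upwards [h2.eventually h1] with q hq hq1
    -- Flow for the fixed time q.1, then for the short time p.2 - q.1, where the local flow near φ x
    -- t₀ is holomorphic.
    have h3 : (fun p : X × ℂ => φ p.1 p.2)
        = (fun p : X × ℂ => φ p.1 p.2) ∘ fun p : X × ℂ => (φ p.1 q.1, p.2 - q.1) := by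
      funext p
      simp [← hφ.apply_add hv]
    change ContMDiffAt _ _ _ _ _
    rw [h3]
    have h4 : ContMDiffAt (𝓘(ℂ, E).prod 𝓘(ℂ, ℂ)) 𝓘(ℂ, E) ω (fun p : X × ℂ => φ p.1 q.1)
        (x, q.2) := by
      have h5 : ContMDiffAt (𝓘(ℂ, E).prod 𝓘(ℂ, ℂ)) (𝓘(ℂ, E).prod 𝓘(ℂ, ℂ)) ω
          (fun p : X × ℂ => (p.1, q.1)) (x, q.2) := contMDiffAt_fst.prodMk contMDiffAt_const
      have h7 : ContMDiffAt (𝓘(ℂ, E).prod 𝓘(ℂ, ℂ)) 𝓘(ℂ, E) ω (fun p : X × ℂ => φ p.1 p.2)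
        (x, q.1) := hq1
      exact ContMDiffAt.comp (x, q.2) h7 h5
    have h6 : ContMDiffAt (𝓘(ℂ, E).prod 𝓘(ℂ, ℂ)) 𝓘(ℂ, ℂ) ω (fun p : X × ℂ => p.2 - q.1)
        (x, q.2) := by
      have h7 : ContMDiff 𝓘(ℂ, ℂ) 𝓘(ℂ, ℂ) ω (fun s : ℂ => s - q.1) :=
        (contDiff_id.sub contDiff_const).contMDiff
      exact h7.contMDiffAt.comp (x, q.2) contMDiffAt_snd
    exact ContMDiffAt.comp (x, q.2) hq (h4.prodMk h6)
  have hclopen : IsClopen S := by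
    constructor
    · rw [← isOpen_compl_iff, isOpen_iff_mem_nhds]
      intro t₀ ht₀
      have h : Tendsto (fun t : ℂ => (t, t₀)) (𝓝 t₀) (𝓝 (t₀, t₀)) :=
        (by fun_prop : Continuous fun t : ℂ => (t, t₀)).continuousAt
      filter_upwards [h.eventually (key t₀)] with t ht hS
      exact ht₀ (ht hS)
    · rw [isOpen_iff_mem_nhds]
      intro t₀ ht₀
      have h : Tendsto (fun t : ℂ => (t₀, t)) (𝓝 t₀) (𝓝 (t₀, t₀)) :=
        (by fun_prop : Continuous fun t : ℂ => (t₀, t)).continuousAt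
      filter_upwards [h.eventually (key t₀)] with t ht
      exact ht ht₀
  have huniv := hclopen.eq_univ ⟨0, hφ.contMDiffAt_zero hv x⟩
  exact (huniv ▸ mem_univ t : t ∈ S)

theorem IsComplexFlow.contMDiff_time (hv : IsHolomorphicVectorField E v)
    (hφ : IsComplexFlow E v φ) (t : ℂ) :
    ContMDiff 𝓘(ℂ, E) 𝓘(ℂ, E) ω (fun x => φ x t) :=
  (hφ.contMDiff hv).comp (contMDiff_id.prodMk contMDiff_const)

/-- The time-`t` map of a complete holomorphic flow, as a holomorphic automorphism. -/
def IsComplexFlow.toAutHol (hv : IsHolomorphicVectorField E v) (hφ : IsComplexFlow E v φ)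
    (t : ℂ) : AutHol E X :=
  ⟨{ toFun := fun x => φ x t
     invFun := fun x => φ x (-t)
     left_inv := fun x => by simp [← hφ.apply_add hv, hφ.apply_zero]
     right_inv := fun x => by simp [← hφ.apply_add hv, hφ.apply_zero] },
    hφ.contMDiff_time hv t, hφ.contMDiff_time hv (-t)⟩

theorem IsComplexFlow.toAutHol_mem (hv : IsHolomorphicVectorField E v) (hφ : IsComplexFlow E v φ)
    (t : ℂ) : hφ.toAutHol hv t ∈ SAutHol E X :=
  Subgroup.subset_closure ⟨v, hv, φ, hφ, t, fun _ => rfl⟩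

end GlobalFlow

/-! ### The invariant distribution spanned by complete fields -/

section Distribution

variable {E : Type*} [NormedAddCommGroup E] [NormedSpace ℂ E]
  {X : Type*} [TopologicalSpace X] [ChartedSpace E X]

theorem AutHol.contMDiff (g : AutHol E X) : ContMDiff 𝓘(ℂ, E) 𝓘(ℂ, E) ω (fun x : X => g • x) :=
  g.2.1

theorem AutHol.mdifferentiableAt (g : AutHol E X) (x : X) :
    MDifferentiableAt 𝓘(ℂ, E) 𝓘(ℂ, E) (fun x : X => g • x) x :=
  (AutHol.contMDiff g).mdifferentiableAt (by simp)

/-- The push-forward of a vector field under a holomorphic automorphism. -/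
noncomputable def AutHol.pushforward (g : AutHol E X) (v : (y : X) → TangentSpace 𝓘(ℂ, E) y) :
    (y : X) → TangentSpace 𝓘(ℂ, E) y :=
  fun y => (mfderiv 𝓘(ℂ, E) 𝓘(ℂ, E) (fun x : X => g • x) (g⁻¹ • y) (v (g⁻¹ • y)) : E)

theorem AutHol.pushforward_smul (g : AutHol E X) (v : (y : X) → TangentSpace 𝓘(ℂ, E) y) (x : X) :
    AutHol.pushforward g v (g • x) = mfderiv 𝓘(ℂ, E) 𝓘(ℂ, E) (fun x : X => g • x) x (v x) := by
  have h : g⁻¹ • g • x = x := inv_smul_smul g x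
  unfold AutHol.pushforward
  rw [h]

theorem AutHol.mfderiv_injective (g : AutHol E X) (x : X) :
    Function.Injective (mfderiv 𝓘(ℂ, E) 𝓘(ℂ, E) (fun x : X => g • x) x) := by
  have h1 := (AutHol.mdifferentiableAt g⁻¹ (g • x)).hasMFDerivAt.comp x
    (AutHol.mdifferentiableAt g x).hasMFDerivAt
  have h2 : (fun x : X => g⁻¹ • x) ∘ (fun x : X => g • x) = id := by
    funext y; exact inv_smul_smul g y
  rw [h2] at h1
  have h3 := hasMFDerivAt_unique h1 (hasMFDerivAt_id x)
  intro a b hab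
  have h4 := congrArg (mfderiv 𝓘(ℂ, E) 𝓘(ℂ, E) (fun x : X => g⁻¹ • x) (g • x)) hab
  have h5 := fun a => DFunLike.congr_fun h3 a
  exact (h5 a).symm.trans (h4.trans (h5 b))

variable [IsManifold 𝓘(ℂ, E) ω X]

variable (E) in
/-- The subspace of `T_xX` spanned by the values of completely integrable holomorphic fields. -/
noncomputable def completeSpan (x : X) : Submodule ℂ (TangentSpace 𝓘(ℂ, E) x) :=
  Submodule.span ℂ {w : TangentSpace 𝓘(ℂ, E) x |
    ∃ v : (y : X) → TangentSpace 𝓘(ℂ, E) y, IsCompletelyIntegrable E v ∧ v x = w}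

theorem IsCompletelyIntegrable.mem_completeSpan {v : (y : X) → TangentSpace 𝓘(ℂ, E) y}
    (hv : IsCompletelyIntegrable E v) (x : X) : v x ∈ completeSpan E x :=
  Submodule.subset_span ⟨v, hv, rfl⟩

/-- The flow is conjugated by g, and the section is the tangent map of g composed with v and g⁻¹. -/
theorem AutHol.isCompletelyIntegrable_pushforward (g : AutHol E X)
    {v : (y : X) → TangentSpace 𝓘(ℂ, E) y} (hv : IsCompletelyIntegrable E v) :
    IsCompletelyIntegrable E (AutHol.pushforward g v) := by
  obtain ⟨hhol, φ, hφ⟩ := hv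
  constructor
  · have h1 : ContMDiff 𝓘(ℂ, E).tangent 𝓘(ℂ, E).tangent ω
        (tangentMap 𝓘(ℂ, E) 𝓘(ℂ, E) fun x : X => g • x) :=
      (AutHol.contMDiff g).contMDiff_tangentMap le_rfl
    have h2 := h1.comp (hhol.comp (AutHol.contMDiff g⁻¹))
    refine h2.congr fun y => ?_
    have h3 : g • g⁻¹ • y = y := smul_inv_smul g y
    simp only [Function.comp_def, tangentMap]
    exact Bundle.TotalSpace.ext h3.symm HEq.rfl
  · refine ⟨fun y t => g • φ (g⁻¹ • y) t, fun y => ⟨?_, fun t => ?_⟩⟩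
    · simp [hφ.apply_zero]
    · have h1 := (AutHol.mdifferentiableAt g (φ (g⁻¹ • y) t)).hasMFDerivAt.comp t
        (hφ.isComplexIntegralCurve (g⁻¹ • y) t)
      refine h1.congr_mfderiv ?_
      rw [AutHol.pushforward_smul]
      let L : E →L[ℂ] E := mfderiv 𝓘(ℂ, E) 𝓘(ℂ, E) (fun x : X => g • x) (φ (g⁻¹ • y) t)
      let w : E := v (φ (g⁻¹ • y) t)
      have h2 : L ∘L (1 : ℂ →L[ℂ] ℂ).smulRight w = (1 : ℂ →L[ℂ] ℂ).smulRight (L w) :=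
        ContinuousLinearMap.ext fun a => L.map_smul a w
      exact h2

/-- Generators go to values of push-forwards. This invariance takes the place of involutivity. -/
theorem AutHol.mfderiv_mem_completeSpan (g : AutHol E X) (x : X) {w : TangentSpace 𝓘(ℂ, E) x}
    (hw : w ∈ completeSpan E x) :
    mfderiv 𝓘(ℂ, E) 𝓘(ℂ, E) (fun x : X => g • x) x w ∈ completeSpan E (g • x) := by
  induction hw using Submodule.span_induction with
  | mem w hw =>
    obtain ⟨v, hv, rfl⟩ := hw
    rw [← AutHol.pushforward_smul]
    exact (AutHol.isCompletelyIntegrable_pushforward g hv).mem_completeSpan _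
  | zero => rw [map_zero]; exact Submodule.zero_mem _
  | add a b _ _ ha hb => rw [map_add]; exact Submodule.add_mem _ ha hb
  | smul c a _ ha => rw [map_smul]; exact Submodule.smul_mem _ c ha

variable [FiniteDimensional ℂ E]

theorem AutHol.finrank_completeSpan_le (g : AutHol E X) (x : X) :
    Module.finrank ℂ (completeSpan E x) ≤ Module.finrank ℂ (completeSpan E (g • x)) := by
  have : FiniteDimensional ℂ (TangentSpace 𝓘(ℂ, E) (g • x)) :=
    inferInstanceAs (FiniteDimensional ℂ E)
  let L : TangentSpace 𝓘(ℂ, E) x →ₗ[ℂ] TangentSpace 𝓘(ℂ, E) (g • x) :=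
    (mfderiv 𝓘(ℂ, E) 𝓘(ℂ, E) (fun x : X => g • x) x).toLinearMap
  exact LinearMap.finrank_le_finrank_of_injective
    (f := L.restrict fun w hw => AutHol.mfderiv_mem_completeSpan g x hw)
    fun a b hab => Subtype.ext (AutHol.mfderiv_injective g x (congrArg Subtype.val hab))

theorem AutHol.finrank_completeSpan_smul (g : AutHol E X) (x : X) :
    Module.finrank ℂ (completeSpan E (g • x)) = Module.finrank ℂ (completeSpan E x) := by
  refine le_antisymm ?_ (AutHol.finrank_completeSpan_le g x)
  have h := AutHol.finrank_completeSpan_le g⁻¹ (g • x)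
  rwa [inv_smul_smul] at h

end Distribution

/-! ### Compositions of several flows -/

section MultiFlow

variable {E : Type*} [NormedAddCommGroup E] [NormedSpace ℂ E]
  {X : Type*} [TopologicalSpace X] [ChartedSpace E X]

/-- The composition, along a list of indices, of the time-`t i` maps of a family of flows. -/
def multiFlow {ι : Type*} (φ : ι → X → ℂ → X) (l : List ι) (t : ι → ℂ) (y : X) : X :=
  l.foldr (fun i z => φ i z (t i)) y

variable {ι : Type*} {v : ι → (x : X) → TangentSpace 𝓘(ℂ, E) x} {φ : ι → X → ℂ → X}

theorem multiFlow_zero (hφ : ∀ i, IsComplexFlow E (v i) (φ i)) (l : List ι) (y : X) :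
    multiFlow φ l 0 y = y := by
  induction l with
  | nil => rfl
  | cons i l ih =>
    change φ i (multiFlow φ l 0 y) 0 = y
    rw [ih, (hφ i).apply_zero]

variable [IsManifold 𝓘(ℂ, E) ω X] [CompleteSpace E] [T2Space X]

theorem exists_mem_SAutHol_multiFlow (hv : ∀ i, IsHolomorphicVectorField E (v i))
    (hφ : ∀ i, IsComplexFlow E (v i) (φ i)) (l : List ι) (t : ι → ℂ) :
    ∃ g : SAutHol E X, ∀ y, multiFlow φ l t y = g • y := by
  induction l with
  | nil => exact ⟨1, fun y => (one_smul _ y).symm⟩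
  | cons i l ih =>
    obtain ⟨g, hg⟩ := ih
    refine ⟨⟨(hφ i).toAutHol (hv i) (t i), (hφ i).toAutHol_mem (hv i) (t i)⟩ * g, fun y => ?_⟩
    change φ i (multiFlow φ l t y) (t i) = _
    rw [hg, mul_smul]
    rfl

variable [Fintype ι]

theorem contMDiff_multiFlow (hv : ∀ i, IsHolomorphicVectorField E (v i))
    (hφ : ∀ i, IsComplexFlow E (v i) (φ i)) (l : List ι) :
    ContMDiff (𝓘(ℂ, ι → ℂ).prod 𝓘(ℂ, E)) 𝓘(ℂ, E) ω
      (fun p : (ι → ℂ) × X => multiFlow φ l p.1 p.2) := by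
  induction l with
  | nil => exact contMDiff_snd
  | cons i l ih =>
    have h1 : ContMDiff (𝓘(ℂ, ι → ℂ).prod 𝓘(ℂ, E)) 𝓘(ℂ, ℂ) ω
        (fun p : (ι → ℂ) × X => p.1 i) := by
      have h2 : ContMDiff 𝓘(ℂ, ι → ℂ) 𝓘(ℂ, ℂ) ω (fun t : ι → ℂ => t i) :=
        (contDiff_apply ℂ ℂ i).contMDiff
      exact h2.comp contMDiff_fst
    exact ((hφ i).contMDiff (hv i)).comp (ih.prodMk h1)

theorem contMDiff_multiFlow_left (hv : ∀ i, IsHolomorphicVectorField E (v i))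
    (hφ : ∀ i, IsComplexFlow E (v i) (φ i)) (l : List ι) (y : X) :
    ContMDiff 𝓘(ℂ, ι → ℂ) 𝓘(ℂ, E) ω (fun t : ι → ℂ => multiFlow φ l t y) :=
  (contMDiff_multiFlow hv hφ l).comp (contMDiff_id.prodMk contMDiff_const)

/-- Chain rule for the jointly holomorphic flow: its differential is the sum of the space part and
the time part, and the latter is the field. -/
theorem mfderiv_multiFlow_cons (hv : ∀ i, IsHolomorphicVectorField E (v i))
    (hφ : ∀ i, IsComplexFlow E (v i) (φ i)) (i : ι) (l : List ι) (y : X) (t τ : ι → ℂ) :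
    mfderiv 𝓘(ℂ, ι → ℂ) 𝓘(ℂ, E) (fun t => multiFlow φ (i :: l) t y) t τ =
      (mfderiv 𝓘(ℂ, E) 𝓘(ℂ, E) (fun x => φ i x (t i)) (multiFlow φ l t y)
        (mfderiv 𝓘(ℂ, ι → ℂ) 𝓘(ℂ, E) (fun t => multiFlow φ l t y) t τ) +
      τ i • v i (φ i (multiFlow φ l t y) (t i)) : TangentSpace 𝓘(ℂ, E) _) := by
  have h1 : HasMFDerivAt 𝓘(ℂ, ι → ℂ) 𝓘(ℂ, ℂ) (fun t : ι → ℂ => t i) t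
      (ContinuousLinearMap.proj (R := ℂ) (φ := fun _ : ι => ℂ) i) :=
    (ContinuousLinearMap.proj (R := ℂ) (φ := fun _ : ι => ℂ) i).hasFDerivAt.hasMFDerivAt
  have h2 := ((contMDiff_multiFlow_left hv hφ l y).mdifferentiableAt (by simp)
    (x := t)).hasMFDerivAt
  have h3 : MDifferentiableAt (𝓘(ℂ, E).prod 𝓘(ℂ, ℂ)) 𝓘(ℂ, E) (fun p : X × ℂ => φ i p.1 p.2)
    (multiFlow φ l t y, t i) := ((hφ i).contMDiff (hv i)).mdifferentiableAt (by simp)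
  have h4 := (HasMFDerivAt.comp t h3.hasMFDerivAt (h2.prodMk h1)).mfderiv
  have h5 := DFunLike.congr_fun h4 τ
  refine h5.trans ?_
  let w : E × ℂ := (mfderiv 𝓘(ℂ, ι → ℂ) 𝓘(ℂ, E) (fun t => multiFlow φ l t y) t τ, τ i)
  have h6 := mfderiv_prod_eq_add_apply (v := w) h3
  refine h6.trans ?_
  have h7 := ((hφ i).isComplexIntegralCurve (multiFlow φ l t y) (t i)).mfderiv
  have h8 := DFunLike.congr_fun h7 (τ i)
  exact congrArg₂ (· + ·) rfl h8

/-- Each further flow preserves the distribution and adds a multiple of a complete field. No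
smallness of t is needed, so the whole parameter space is tangent. -/
theorem mfderiv_multiFlow_mem (hv : ∀ i, IsHolomorphicVectorField E (v i))
    (hφ : ∀ i, IsComplexFlow E (v i) (φ i)) (l : List ι) (y : X) (t τ : ι → ℂ) :
    mfderiv 𝓘(ℂ, ι → ℂ) 𝓘(ℂ, E) (fun t => multiFlow φ l t y) t τ ∈
      completeSpan E (multiFlow φ l t y) := by
  induction l with
  | nil =>
    have h : mfderiv 𝓘(ℂ, ι → ℂ) 𝓘(ℂ, E) (fun t => multiFlow φ [] t y) t = 0 :=
      mfderiv_const
    rw [h]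
    exact Submodule.zero_mem _
  | cons i l ih =>
    rw [mfderiv_multiFlow_cons hv hφ]
    refine Submodule.add_mem _ ?_ (Submodule.smul_mem _ _ ?_)
    · exact AutHol.mfderiv_mem_completeSpan ((hφ i).toAutHol (hv i) (t i)) _ ih
    · exact IsCompletelyIntegrable.mem_completeSpan ⟨hv i, φ i, hφ i⟩ _

theorem mfderiv_multiFlow_zero (hv : ∀ i, IsHolomorphicVectorField E (v i))
    (hφ : ∀ i, IsComplexFlow E (v i) (φ i)) (l : List ι) (y : X) {b : ι → E}
    (hb : ∀ i, v i y = b i) (τ : ι → ℂ) :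
    mfderiv 𝓘(ℂ, ι → ℂ) 𝓘(ℂ, E) (fun t => multiFlow φ l t y) 0 τ =
      (l.map fun i => τ i • b i).sum := by
  induction l with
  | nil =>
    have h : mfderiv 𝓘(ℂ, ι → ℂ) 𝓘(ℂ, E) (fun t => multiFlow φ [] t y) 0 = 0 :=
      mfderiv_const
    rw [h]
    rfl
  | cons i l ih =>
    refine (mfderiv_multiFlow_cons hv hφ i l y 0 τ).trans ?_
    have h1 : (fun x => φ i x ((0 : ι → ℂ) i)) = id := by
      funext x; exact (hφ i).apply_zero x
    rw [h1, mfderiv_id, List.map_cons, List.sum_cons, add_comm]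
    refine congrArg₂ (fun a b : E => a + b) ?_ ih
    have h2 : φ i (multiFlow φ l 0 y) ((0 : ι → ℂ) i) = y := by
      rw [multiFlow_zero hφ]; exact (hφ i).apply_zero y
    rw [← hb i]
    change τ i • v i (φ i (multiFlow φ l 0 y) ((0 : ι → ℂ) i)) = _
    rw [h2]
    rfl

end MultiFlow

/-! ### Flow boxes as local coordinates -/

section FlowBox

/-- If `A` has the left inverse `B` and maps `T × 0` into a subspace of dimension at most `dim T`,
then `B` maps this subspace into `T × 0`. -/
theorem LinearMap.snd_eq_zero_of_leftInverse {T W V : Type*} [AddCommGroup T] [Module ℂ T]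
    [AddCommGroup W] [Module ℂ W] [AddCommGroup V] [Module ℂ V]
    [FiniteDimensional ℂ V] {A : T × W →ₗ[ℂ] V} {B : V →ₗ[ℂ] T × W}
    (hBA : ∀ q, B (A q) = q) {D : Submodule ℂ V} (hA : ∀ τ, A (τ, 0) ∈ D)
    (hD : Module.finrank ℂ D ≤ Module.finrank ℂ T) {w : V} (hw : w ∈ D) : (B w).2 = 0 := by
  let L : T →ₗ[ℂ] V := A ∘ₗ LinearMap.inl ℂ T W
  have hL : Function.Injective L := by
    intro a b hab
    have h := congrArg B hab
    simp only [L, LinearMap.comp_apply, LinearMap.inl_apply, hBA] at h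
    exact congrArg Prod.fst h
  have hle : LinearMap.range L ≤ D := by
    rintro _ ⟨τ, rfl⟩
    exact hA τ
  have heq : LinearMap.range L = D := by
    refine Submodule.eq_of_le_of_finrank_le hle ?_
    rwa [LinearMap.finrank_range_of_inj hL]
  obtain ⟨τ, rfl⟩ := heq ▸ hw
  simp only [L, LinearMap.comp_apply, LinearMap.inl_apply, hBA]

variable {E : Type*} [NormedAddCommGroup E] [NormedSpace ℂ E]
  {X : Type*} [TopologicalSpace X] [ChartedSpace E X]

theorem HasMFDerivAt.hasFDerivAt_extChartAt_comp {P : Type*} [NormedAddCommGroup P]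
    [NormedSpace ℂ P] {F : P → X} {p : P} {x : X} (hx : F p = x)
    {L : P →L[ℂ] E} (hF : HasMFDerivAt 𝓘(ℂ, P) 𝓘(ℂ, E) F p L) :
    HasFDerivAt (fun q => extChartAt 𝓘(ℂ, E) x (F q)) L p := by
  subst hx
  have h : HasFDerivWithinAt (fun q => extChartAt 𝓘(ℂ, E) (F p) (F q)) L (range id) p := hF.2
  rwa [range_id, hasFDerivWithinAt_univ] at h

/-- Translation of a point along a subspace, in the preferred chart. -/
noncomputable def chartSlice (x : X) (W : Submodule ℂ E) (w : W) : X :=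
  (extChartAt 𝓘(ℂ, E) x).symm (extChartAt 𝓘(ℂ, E) x x + w)

theorem chartSlice_zero (x : X) (W : Submodule ℂ E) : chartSlice x W 0 = x := by
  simp [chartSlice]

/-- The coordinates around `x` given by a family of flows and a transversal slice. -/
noncomputable def flowBox {ι : Type*} (φ : ι → X → ℂ → X) (l : List ι) (x : X) (W : Submodule ℂ E)
    (p : (ι → ℂ) × W) : X :=
  multiFlow φ l p.1 (chartSlice x W p.2)

theorem flowBox_zero {ι : Type*} {v : ι → (x : X) → TangentSpace 𝓘(ℂ, E) x}
    {φ : ι → X → ℂ → X} (hφ : ∀ i, IsComplexFlow E (v i) (φ i)) (l : List ι) (x : X)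
    (W : Submodule ℂ E) : flowBox φ l x W 0 = x := by
  change multiFlow φ l 0 (chartSlice x W 0) = x
  rw [multiFlow_zero hφ, chartSlice_zero]

variable [IsManifold 𝓘(ℂ, E) ω X]

/-- A basis is extracted from the spanning set itself, since a linear combination of complete fields
need not be complete. -/
theorem exists_basis_completeSpan [FiniteDimensional ℂ E] (x : X) :
    ∃ (n : ℕ) (v : Fin n → (y : X) → TangentSpace 𝓘(ℂ, E) y),
      n = Module.finrank ℂ (completeSpan E x) ∧ (∀ i, IsCompletelyIntegrable E (v i)) ∧
      LinearIndependent ℂ (fun i => v i x) ∧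
      Submodule.span ℂ (range fun i => v i x) = completeSpan E x := by
  have : FiniteDimensional ℂ (TangentSpace 𝓘(ℂ, E) x) := inferInstanceAs (FiniteDimensional ℂ E)
  obtain ⟨f, hf, hspan, hli⟩ := Submodule.exists_fun_fin_finrank_span_eq ℂ
    {w : TangentSpace 𝓘(ℂ, E) x |
      ∃ v : (y : X) → TangentSpace 𝓘(ℂ, E) y, IsCompletelyIntegrable E v ∧ v x = w}
  choose v hv hvf using hf
  refine ⟨_, v, rfl, hv, ?_, ?_⟩
  · exact (funext hvf : (fun i => v i x) = f) ▸ hli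
  · exact (funext hvf : (fun i => v i x) = f) ▸ hspan

theorem contMDiffAt_chartSlice (x : X) (W : Submodule ℂ E) :
    ContMDiffAt 𝓘(ℂ, W) 𝓘(ℂ, E) ω (chartSlice x W) 0 := by
  have h1 : ContMDiffAt 𝓘(ℂ, E) 𝓘(ℂ, E) ω (extChartAt 𝓘(ℂ, E) x).symm
      (extChartAt 𝓘(ℂ, E) x x + ((0 : W) : E)) := by
    rw [ZeroMemClass.coe_zero, add_zero]
    exact (contMDiffOn_extChartAt_symm x).contMDiffAt (extChartAt_target_mem_nhds x)
  have h2 : ContMDiffAt 𝓘(ℂ, W) 𝓘(ℂ, E) ω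
      (fun w : W => extChartAt 𝓘(ℂ, E) x x + (w : E)) 0 :=
    (contDiff_const.add W.subtypeL.contDiff).contDiffAt.contMDiffAt
  exact ContMDiffAt.comp (0 : W) (g := (extChartAt 𝓘(ℂ, E) x).symm) h1 h2

variable [FiniteDimensional ℂ E] [T2Space X]
  {ι : Type*} [Fintype ι] {v : ι → (x : X) → TangentSpace 𝓘(ℂ, E) x} {φ : ι → X → ℂ → X}

theorem contMDiffAt_flowBox (hv : ∀ i, IsHolomorphicVectorField E (v i))
    (hφ : ∀ i, IsComplexFlow E (v i) (φ i)) (l : List ι) (x : X) (W : Submodule ℂ E) :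
    ContMDiffAt 𝓘(ℂ, (ι → ℂ) × W) 𝓘(ℂ, E) ω (flowBox φ l x W) 0 := by
  have : CompleteSpace E := FiniteDimensional.complete ℂ E
  have h1 : ContMDiffAt 𝓘(ℂ, (ι → ℂ) × W) 𝓘(ℂ, ι → ℂ) ω (Prod.fst : (ι → ℂ) × W → _) 0 :=
    contDiffAt_fst.contMDiffAt
  have h2 : ContMDiffAt 𝓘(ℂ, (ι → ℂ) × W) 𝓘(ℂ, W) ω (Prod.snd : (ι → ℂ) × W → _) 0 :=
    contDiffAt_snd.contMDiffAt
  have h3 : ContMDiffAt 𝓘(ℂ, (ι → ℂ) × W) 𝓘(ℂ, E) ω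
      (fun p : (ι → ℂ) × W => chartSlice x W p.2) 0 :=
    ContMDiffAt.comp (0 : (ι → ℂ) × W) (g := chartSlice x W) (contMDiffAt_chartSlice x W) h2
  exact (contMDiff_multiFlow hv hφ l).contMDiffAt.comp (0 : (ι → ℂ) × W) (h1.prodMk h3)

/-- The two factors are treated separately: w = 0 leaves the composed flows from x, and t = 0 leaves
the slice, which is affine in the chart. -/
theorem hasFDerivAt_flowBox (hv : ∀ i, IsHolomorphicVectorField E (v i))
    (hφ : ∀ i, IsComplexFlow E (v i) (φ i)) (l : List ι) (x : X) (W : Submodule ℂ E) {b : ι → E}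
    (hb : ∀ i, v i x = b i) :
    ∃ A : (ι → ℂ) × W →L[ℂ] E,
      HasFDerivAt (fun p => extChartAt 𝓘(ℂ, E) x (flowBox φ l x W p)) A 0 ∧
      ∀ τ w, A (τ, w) = (l.map fun i => τ i • b i).sum + w := by
  have : CompleteSpace E := FiniteDimensional.complete ℂ E
  have hG := ((contMDiffAt_flowBox hv hφ l x W).mdifferentiableAt (by simp)).hasMFDerivAt
  let A : (ι → ℂ) × W →L[ℂ] E := mfderiv 𝓘(ℂ, (ι → ℂ) × W) 𝓘(ℂ, E) (flowBox φ l x W) 0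
  have hA := hG.hasFDerivAt_extChartAt_comp (L := A) (flowBox_zero hφ l x W)
  refine ⟨A, hA, fun τ w => ?_⟩
  have h1 : A (τ, 0) = (l.map fun i => τ i • b i).sum := by
    rw [← mfderiv_multiFlow_zero hv hφ l x hb]
    have h2 := HasFDerivAt.comp (0 : ι → ℂ) (f := fun t : ι → ℂ => (t, (0 : W))) hA
      (hasFDerivAt_prodMk_left 0 0)
    have h3 := ((contMDiff_multiFlow_left hv hφ l x).mdifferentiableAt (by simp)
      (x := (0 : ι → ℂ))).hasMFDerivAt
    let B : (ι → ℂ) →L[ℂ] E :=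
      mfderiv 𝓘(ℂ, ι → ℂ) 𝓘(ℂ, E) (fun t => multiFlow φ l t x) 0
    have h4 := h3.hasFDerivAt_extChartAt_comp (F := fun t => multiFlow φ l t x) (L := B)
      (multiFlow_zero hφ l x)
    have h5 : (fun p => extChartAt 𝓘(ℂ, E) x (flowBox φ l x W p)) ∘
        (fun t : ι → ℂ => (t, (0 : W))) = fun t => extChartAt 𝓘(ℂ, E) x (multiFlow φ l t x) := by
      funext t
      simp [flowBox, chartSlice_zero]
    rw [h5] at h2
    exact DFunLike.congr_fun (h2.unique h4) τ
  have h2 : A (0, w) = w := by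
    have h3 := HasFDerivAt.comp (0 : W) (f := fun w : W => ((0 : ι → ℂ), w)) hA
      (hasFDerivAt_prodMk_right 0 0)
    have h4 : HasFDerivAt (fun w : W => extChartAt 𝓘(ℂ, E) x x + (w : E)) W.subtypeL 0 :=
      W.subtypeL.hasFDerivAt.const_add _
    have h5 : (fun p => extChartAt 𝓘(ℂ, E) x (flowBox φ l x W p)) ∘
        (fun w : W => ((0 : ι → ℂ), w)) =ᶠ[𝓝 0] fun w => extChartAt 𝓘(ℂ, E) x x + (w : E) := by
      have h6 : Tendsto (fun w : W => extChartAt 𝓘(ℂ, E) x x + (w : E)) (𝓝 0)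
          (𝓝 (extChartAt 𝓘(ℂ, E) x x)) := by
        have := h4.continuousAt.tendsto; simpa using this
      filter_upwards [h6.eventually (extChartAt_target_mem_nhds x)] with w hw
      simp only [Function.comp_apply, flowBox, multiFlow_zero hφ, chartSlice]
      exact (extChartAt 𝓘(ℂ, E) x).right_inv hw
    exact DFunLike.congr_fun (h3.unique (h4.congr_of_eventuallyEq h5)) w
  have h3 : ((τ, w) : (ι → ℂ) × W) = (τ, 0) + (0, w) := by simp
  rw [h3, map_add, h1, h2]

/-- A flow box along a basis of the distribution is a local biholomorphism. -/
theorem exists_inverse_flowBox {n : ℕ} {v : Fin n → (x : X) → TangentSpace 𝓘(ℂ, E) x}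
    {φ : Fin n → X → ℂ → X} (hv : ∀ i, IsHolomorphicVectorField E (v i))
    (hφ : ∀ i, IsComplexFlow E (v i) (φ i)) (x : X) (W : Submodule ℂ E)
    {b : Fin n → E} (hb : ∀ i, v i x = b i) (hli : LinearIndependent ℂ b)
    (hW : IsCompl (Submodule.span ℂ (range b)) W) :
    ∃ ψ : X → (Fin n → ℂ) × W, ContMDiffAt 𝓘(ℂ, E) 𝓘(ℂ, (Fin n → ℂ) × W) ω ψ x ∧ ψ x = 0 ∧
      (∀ᶠ p in 𝓝 0, ψ (flowBox φ (List.finRange n) x W p) = p) ∧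
      ∀ᶠ y in 𝓝 x, flowBox φ (List.finRange n) x W (ψ y) = y := by
  have : CompleteSpace E := FiniteDimensional.complete ℂ E
  set G := flowBox φ (List.finRange n) x W with hGdef
  set e := extChartAt 𝓘(ℂ, E) x with he
  have hG : ContMDiffAt 𝓘(ℂ, (Fin n → ℂ) × W) 𝓘(ℂ, E) ω G 0 := contMDiffAt_flowBox hv hφ _ x W
  have hG0 : G 0 = x := flowBox_zero hφ _ x W
  obtain ⟨A, hA, hAeq⟩ := hasFDerivAt_flowBox hv hφ (List.finRange n) x W hb
  have hAeq' : ∀ τ w, A (τ, w) = ∑ i, τ i • b i + w := by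
    intro τ w
    rw [hAeq, ← List.ofFn_eq_map, List.sum_ofFn]
  have hinj : Function.Injective A := by
    rw [injective_iff_map_eq_zero]
    rintro ⟨τ, w⟩ h
    rw [hAeq'] at h
    have hmem : ∑ i, τ i • b i ∈ Submodule.span ℂ (range b) :=
      Submodule.sum_mem _ fun i _ => Submodule.smul_mem _ _ (Submodule.subset_span ⟨i, rfl⟩)
    have h1 : ∑ i, τ i • b i = 0 := by
      refine Submodule.disjoint_def.1 hW.disjoint _ hmem ?_
      rw [eq_neg_of_add_eq_zero_left h]
      exact W.neg_mem w.2
    rw [h1, zero_add] at h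
    have h2 := Fintype.linearIndependent_iff.1 hli τ h1
    exact Prod.ext (funext h2) (Subtype.ext h)
  have hsurj : Function.Surjective A := by
    intro z
    have hz : z ∈ Submodule.span ℂ (range b) ⊔ W := by
      rw [hW.sup_eq_top]; exact Submodule.mem_top
    obtain ⟨a, ha, w, hw, rfl⟩ := Submodule.mem_sup.1 hz
    obtain ⟨τ, rfl⟩ := (Submodule.mem_span_range_iff_exists_fun ℂ).1 ha
    exact ⟨(τ, ⟨w, hw⟩), hAeq' _ _⟩
  let A' : ((Fin n → ℂ) × W) ≃L[ℂ] E :=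
    (LinearEquiv.ofBijective A.toLinearMap ⟨hinj, hsurj⟩).toContinuousLinearEquiv
  have hA' : HasFDerivAt (fun p => e (G p)) (A' : (Fin n → ℂ) × W →L[ℂ] E) 0 := hA
  have heG : ContDiffAt ℂ ω (fun p => e (G p)) 0 := by
    rw [← contMDiffAt_iff_contDiffAt]
    refine ContMDiffAt.comp (0 : (Fin n → ℂ) × W) ?_ hG
    rw [hG0]
    exact contMDiffAt_extChartAt
  have heG0 : e (G 0) = e x := by rw [hG0]
  let θ := heG.localInverse hA' (by simp)
  have hθ : ContDiffAt ℂ ω θ (e x) := heG0 ▸ heG.to_localInverse hA' (by simp)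
  have hθ0 : θ (e x) = 0 := heG0 ▸ heG.localInverse_apply_image hA' (by simp)
  have hstrict := heG.hasStrictFDerivAt' hA' (by simp)
  have hψ : ContMDiffAt 𝓘(ℂ, E) 𝓘(ℂ, (Fin n → ℂ) × W) ω (fun y => θ (e y)) x :=
    hθ.contMDiffAt.comp x contMDiffAt_extChartAt
  refine ⟨fun y => θ (e y), hψ, hθ0, hstrict.eventually_left_inverse, ?_⟩
  have h1 : ∀ᶠ z in 𝓝 (e x), e (G (θ z)) = z := heG0 ▸ hstrict.eventually_right_inverse
  -- The chart is injective only on its source, so the identity e (G (θ (e y))) = e y descends to X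
  -- only once both points lie there.
  have h2 : ∀ᶠ y in 𝓝 x, G (θ (e y)) ∈ e.source := by
    have h3 : ContinuousAt (fun y => G (θ (e y))) x := by
      refine ContinuousAt.comp (g := G) (f := fun y => θ (e y)) ?_ hψ.continuousAt
      rw [hθ0]; exact hG.continuousAt
    refine h3.eventually ?_
    change e.source ∈ 𝓝 (G (θ (e x)))
    rw [hθ0, hG0]
    exact extChartAt_source_mem_nhds x
  filter_upwards [(continuousAt_extChartAt x).eventually h1, h2,
    extChartAt_source_mem_nhds (I := 𝓘(ℂ, E)) x] with y hy1 hy2 hy3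
  exact e.injOn hy2 hy3 hy1

end FlowBox

/-! ### Flexibility implies transitivity -/

section Flexible

variable {E : Type*} [NormedAddCommGroup E] [NormedSpace ℂ E] [FiniteDimensional ℂ E]
  {X : Type*} [TopologicalSpace X] [T2Space X] [ChartedSpace E X] [IsManifold 𝓘(ℂ, E) ω X]

theorem IsHolomorphicallyFlexibleAt.orbit_mem_nhds {x : X}
    (hx : IsHolomorphicallyFlexibleAt E x) : MulAction.orbit (SAutHol E X) x ∈ 𝓝 x := by
  have : CompleteSpace E := FiniteDimensional.complete ℂ E
  obtain ⟨n, v, -, hv, hli, hspan⟩ := exists_basis_completeSpan (E := E) x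
  choose hhol φ hφ using hv
  have hspan' : Submodule.span ℂ (range fun i => v i x) = ⊤ := hspan.trans hx
  -- The fields already span, so the slice is the point x and every point of the box is reached from
  -- x by flows.
  obtain ⟨ψ, -, -, -, hψ⟩ := exists_inverse_flowBox hhol hφ x ⊥ (b := fun i => v i x)
    (fun i => rfl) hli (IsCompl.of_eq (inf_bot_eq _) (by rw [sup_bot_eq]; exact hspan'))
  filter_upwards [hψ] with y hy
  obtain ⟨g, hg⟩ := exists_mem_SAutHol_multiFlow hhol hφ (List.finRange _) (ψ y).1
  refine ⟨g, ?_⟩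
  have h0 : (ψ y).2 = 0 := Subsingleton.elim _ _
  rw [flowBox, h0, chartSlice_zero, hg] at hy
  exact hy

theorem IsHolomorphicallyFlexible.isPretransitive_SAutHol [ConnectedSpace X]
    (hX : IsHolomorphicallyFlexible E X) : MulAction.IsPretransitive (SAutHol E X) X := by
  have hopen : ∀ x : X, IsOpen (MulAction.orbit (SAutHol E X) x) := by
    intro x
    refine isOpen_iff_mem_nhds.2 fun y hy => ?_
    rw [← MulAction.orbit_eq_iff.2 hy]
    exact (hX y).orbit_mem_nhds
  refine ⟨fun x y => ?_⟩
  have hclopen : IsClopen (MulAction.orbit (SAutHol E X) x) := by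
    refine ⟨⟨isOpen_iff_mem_nhds.2 fun z hz => ?_⟩, hopen x⟩
    filter_upwards [(hopen z).mem_nhds (MulAction.mem_orbit_self z)] with w hw hwx
    refine hz ?_
    rw [← MulAction.orbit_eq_iff.2 hwx, MulAction.orbit_eq_iff.2 hw]
    exact MulAction.mem_orbit_self z
  have huniv := hclopen.eq_univ ⟨x, MulAction.mem_orbit_self x⟩
  exact (huniv ▸ mem_univ y : y ∈ MulAction.orbit (SAutHol E X) x)

end Flexible

/-! ### Transitivity implies flexibility -/

section Foliation

/-- A function with vanishing derivative is locally constant. -/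
theorem eventually_eq_of_hasFDerivAt_zero {T F : Type*} [NormedAddCommGroup T] [NormedSpace ℂ T]
    [NormedAddCommGroup F] [NormedSpace ℂ F] {f : T → F} {t₀ : T}
    (hf : ∀ᶠ t in 𝓝 t₀, HasFDerivAt f (0 : T →L[ℂ] F) t) : ∀ᶠ t in 𝓝 t₀, f t = f t₀ := by
  obtain ⟨ε, hε, hball⟩ := Metric.eventually_nhds_iff_ball.1 hf
  filter_upwards [Metric.ball_mem_nhds t₀ hε] with t ht
  exact Metric.isOpen_ball.is_const_of_fderiv_eq_zero (𝕜 := ℂ)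
    (convex_ball t₀ ε).isPreconnected
    (fun s hs => (hball s hs).differentiableAt.differentiableWithinAt)
    (fun s hs => (hball s hs).fderiv) ht (Metric.mem_ball_self hε)

/-- O may be disconnected, but countably many neighbourhoods on which f is constant cover it. -/
theorem countable_image_of_hasFDerivAt_zero {T F : Type*} [NormedAddCommGroup T] [NormedSpace ℂ T]
    [SecondCountableTopology T] [NormedAddCommGroup F] [NormedSpace ℂ F] {f : T → F} {O : Set T}
    (hO : IsOpen O) (hf : ∀ t ∈ O, HasFDerivAt f (0 : T →L[ℂ] F) t) : (f '' O).Countable := by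
  have hloc : ∀ t ∈ O, {s | f s = f t} ∈ 𝓝[O] t := fun t ht => mem_nhdsWithin_of_mem_nhds
    (eventually_eq_of_hasFDerivAt_zero (hO.eventually_mem ht |>.mono hf))
  obtain ⟨S, -, hS, hcover⟩ := TopologicalSpace.countable_cover_nhdsWithin hloc
  refine (hS.image f).mono ?_
  rintro _ ⟨t, ht, rfl⟩
  obtain ⟨s, hs, hts⟩ := mem_iUnion₂.1 (hcover ht)
  exact ⟨s, hs, Eq.symm hts⟩

/-- A set that has with each point only countably many successors is contained in a countable
set closed under successors. -/
theorem exists_countable_closed {α : Type*} (step : α → Set α) (hstep : ∀ a, (step a).Countable)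
    (a₀ : α) : ∃ C : Set α, C.Countable ∧ a₀ ∈ C ∧ ∀ a ∈ C, step a ⊆ C := by
  let D : ℕ → Set α := fun n => n.rec {a₀} fun _ S => ⋃ a ∈ S, step a
  have hD : ∀ n, (D n).Countable := by
    intro n
    induction n with
    | zero => exact countable_singleton a₀
    | succ n ih => exact ih.biUnion fun a _ => hstep a
  refine ⟨⋃ n, D n, countable_iUnion hD, mem_iUnion.2 ⟨0, rfl⟩, fun a ha b hb => ?_⟩
  obtain ⟨n, hn⟩ := mem_iUnion.1 ha
  exact mem_iUnion.2 ⟨n + 1, mem_iUnion₂.2 ⟨a, hn, hb⟩⟩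

variable {E : Type*} [NormedAddCommGroup E] [NormedSpace ℂ E]
  {X : Type*} [TopologicalSpace X] [ChartedSpace E X] [IsManifold 𝓘(ℂ, E) ω X]

variable (E) in
/-- The image of `p` is tangent to the distribution spanned by the completely integrable fields. -/
def IsTangentMap {P : Type*} [NormedAddCommGroup P] [NormedSpace ℂ P] (p : P → X) : Prop :=
  ∀ t, MDifferentiableAt 𝓘(ℂ, P) 𝓘(ℂ, E) p t ∧
    ∀ τ : P, mfderiv 𝓘(ℂ, P) 𝓘(ℂ, E) p t τ ∈ completeSpan E (p t)

/-- The function `s` is, on the open set `U`, constant along the distribution spanned by the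
completely integrable fields, and each of its fibres is covered by a single tangent map. -/
structure IsFoliatedChart (U : Set X) (s : X → E) : Prop where
  isOpen : IsOpen U
  mdifferentiableAt : ∀ y ∈ U, MDifferentiableAt 𝓘(ℂ, E) 𝓘(ℂ, E) s y
  mfderiv_eq_zero : ∀ y ∈ U, ∀ w ∈ completeSpan E y, mfderiv 𝓘(ℂ, E) 𝓘(ℂ, E) s y w = 0
  exists_tangentMap : ∀ c : E, ∃ (n : ℕ) (p : (Fin n → ℂ) → X), IsTangentMap E p ∧
    ∀ y ∈ U, s y = c → y ∈ range p

theorem IsTangentMap.continuous {P : Type*} [NormedAddCommGroup P] [NormedSpace ℂ P] {p : P → X}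
    (hp : IsTangentMap E p) : Continuous p :=
  continuous_iff_continuousAt.2 fun t => (hp t).1.continuousAt

theorem IsComplexFlow.isTangentMap {v : (x : X) → TangentSpace 𝓘(ℂ, E) x} {φ : X → ℂ → X}
    (hv : IsHolomorphicVectorField E v) (hφ : IsComplexFlow E v φ) (y : X) :
    IsTangentMap E (φ y) := by
  intro t
  have h := hφ.isComplexIntegralCurve y t
  refine ⟨h.mdifferentiableAt, fun τ => ?_⟩
  rw [h.mfderiv]
  exact Submodule.smul_mem _ (τ : ℂ) (IsCompletelyIntegrable.mem_completeSpan ⟨hv, φ, hφ⟩ (φ y t))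

theorem IsFoliatedChart.hasFDerivAt_comp {U : Set X} {s : X → E} (hU : IsFoliatedChart U s)
    {P : Type*} [NormedAddCommGroup P] [NormedSpace ℂ P] {p : P → X} (hp : IsTangentMap E p)
    {t : P} (ht : p t ∈ U) : HasFDerivAt (fun t => s (p t)) (0 : P →L[ℂ] E) t := by
  have h := HasMFDerivAt.comp t (hU.mdifferentiableAt _ ht).hasMFDerivAt (hp t).1.hasMFDerivAt
  refine HasMFDerivAt.hasFDerivAt (h.congr_mfderiv ?_)
  exact ContinuousLinearMap.ext fun τ => hU.mfderiv_eq_zero _ ht _ ((hp t).2 τ)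

/-- A plaque, connected or not, lies in the image of one tangent map, along which the other
transversal coordinate is locally constant. -/
theorem IsFoliatedChart.countable_image {U U' : Set X} {s s' : X → E}
    (hU : IsFoliatedChart U s) (hU' : IsFoliatedChart U' s') (c : E) :
    (s' '' {y | y ∈ U ∧ s y = c ∧ y ∈ U'}).Countable := by
  obtain ⟨n, p, hp, hsub⟩ := hU.exists_tangentMap c
  have h := countable_image_of_hasFDerivAt_zero (f := fun t => s' (p t))
    (hU'.isOpen.preimage hp.continuous) (fun t ht => hU'.hasFDerivAt_comp hp ht)
  refine h.mono ?_
  rintro _ ⟨y, ⟨hy, hyc, hy'⟩, rfl⟩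
  obtain ⟨t, rfl⟩ := hsub y hy hyc
  exact ⟨t, hy', rfl⟩

/-- If foliated charts exist around each point and the special automorphisms act transitively, then
the transversal coordinate of each foliated chart takes only countably many values. -/
theorem IsFoliatedChart.countable_image_of_isPretransitive [SecondCountableTopology X]
    [MulAction.IsPretransitive (SAutHol E X) X]
    {U : X → Set X} {s : X → X → E} (hU : ∀ x, IsFoliatedChart (U x) (s x)) (hx : ∀ x, x ∈ U x)
    (x₀ : X) : (s x₀ '' U x₀).Countable := by
  obtain ⟨B, hB, hcover⟩ := TopologicalSpace.countable_cover_nhds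
    fun x => (hU x).isOpen.mem_nhds (hx x)
  let plaque : X × E → Set X := fun q => {y | y ∈ U q.1 ∧ s q.1 y = q.2}
  let step : X × E → Set (X × E) := fun q => {q' | q'.1 ∈ B ∧ (plaque q ∩ plaque q').Nonempty}
  have hstep : ∀ q, (step q).Countable := by
    intro q
    have h : (⋃ b ∈ B, (fun d => (b, d)) ''
        (s b '' {y | y ∈ U q.1 ∧ s q.1 y = q.2 ∧ y ∈ U b})).Countable :=
      hB.biUnion fun b _ => ((hU q.1).countable_image (hU b) q.2).image _
    refine h.mono ?_
    rintro ⟨b, d⟩ ⟨hb, y, hy, hy'⟩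
    exact mem_iUnion₂.2 ⟨b, hb, d, ⟨y, ⟨hy.1, hy.2, hy'.1⟩, hy'.2⟩, rfl⟩
  obtain ⟨C, hC, hC₀, hCstep⟩ := exists_countable_closed step hstep (x₀, s x₀ x₀)
  -- The points reached from x₀ by chains of plaques; a countable union of plaques.
  let L : Set X := {y | ∃ q ∈ C, y ∈ plaque q}
  have hL₀ : x₀ ∈ L := ⟨_, hC₀, hx x₀, rfl⟩
  have hL : ∀ y ∈ L, ∀ b ∈ B, y ∈ U b → ∀ z ∈ U b, s b z = s b y → z ∈ L := by
    rintro y ⟨q, hq, hyq⟩ b hb hy z hz hzy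
    exact ⟨(b, s b y), hCstep q hq ⟨hb, y, hyq, hy, rfl⟩, hz, hzy⟩
  have hflow : ∀ (v : (x : X) → TangentSpace 𝓘(ℂ, E) x) (φ : X → ℂ → X),
      IsHolomorphicVectorField E v → IsComplexFlow E v φ → ∀ y t, φ y t ∈ L ↔ y ∈ L := by
    intro v φ hv hφ y t
    have hp := hφ.isTangentMap hv y
    -- For a short time a flow line stays in one plaque of a chart from B, and L contains each such
    -- plaque that it meets.
    have hloc : ∀ t₀ : ℂ, ∀ᶠ t in 𝓝 t₀, φ y t ∈ L ↔ φ y t₀ ∈ L := by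
      intro t₀
      obtain ⟨b, hb, hyb⟩ := mem_iUnion₂.1 (hcover ▸ mem_univ (φ y t₀))
      have hnear : ∀ᶠ t in 𝓝 t₀, φ y t ∈ U b :=
        hp.continuous.continuousAt.eventually ((hU b).isOpen.mem_nhds hyb)
      have hconst := eventually_eq_of_hasFDerivAt_zero
        (hnear.mono fun t ht => (hU b).hasFDerivAt_comp hp ht)
      filter_upwards [hnear, hconst] with t ht hts
      exact ⟨fun h => hL _ h b hb ht _ hyb hts.symm, fun h => hL _ h b hb hyb _ ht hts⟩
    have hlc : IsLocallyConstant fun t => φ y t ∈ L := by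
      rw [IsLocallyConstant.iff_eventually_eq]
      exact fun t₀ => (hloc t₀).mono fun t ht => propext ht
    have h := hlc.apply_eq_of_isPreconnected isPreconnected_univ (mem_univ t) (mem_univ 0)
    rw [hφ.apply_zero] at h
    exact iff_of_eq h
  have hinv : ∀ g ∈ SAutHol E X, ∀ y : X, g • y ∈ L ↔ y ∈ L := by
    intro g hg
    induction hg using Subgroup.closure_induction with
    | mem g hg =>
      obtain ⟨v, hv, φ, hφ, t, hgt⟩ := hg
      intro y
      rw [hgt]
      exact hflow v φ hv hφ y t
    | one => intro y; rw [one_smul]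
    | mul a b _ _ ha hb => intro y; rw [mul_smul, ha, hb]
    | inv a _ ha => intro y; rw [← ha, smul_inv_smul]
  have huniv : ∀ y, y ∈ L := by
    intro y
    obtain ⟨g, rfl⟩ := MulAction.exists_smul_eq (SAutHol E X) x₀ y
    exact (hinv g g.2 x₀).2 hL₀
  have h : (⋃ q ∈ C, s x₀ '' {y | y ∈ U q.1 ∧ s q.1 y = q.2 ∧ y ∈ U x₀}).Countable :=
    hC.biUnion fun q _ => (hU q.1).countable_image (hU x₀) q.2
  refine h.mono ?_
  rintro _ ⟨y, hy, rfl⟩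
  obtain ⟨q, hq, hyq⟩ := huniv y
  exact mem_iUnion₂.2 ⟨q, hq, y, ⟨hyq.1, hyq.2, hy⟩, rfl⟩

variable [FiniteDimensional ℂ E] [T2Space X]

/-- If the distribution spanned by the completely integrable fields has constant rank, there are
foliated charts around each point. -/
theorem exists_isFoliatedChart {r : ℕ} (hr : ∀ y : X, Module.finrank ℂ (completeSpan E y) = r)
    (x : X) : ∃ (U : Set X) (s : X → E), IsFoliatedChart U s ∧ x ∈ U ∧
      (r < Module.finrank ℂ E → ¬ (s '' U).Countable) := by
  have : CompleteSpace E := FiniteDimensional.complete ℂ E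
  obtain ⟨n, v, hn, hv, hli, -⟩ := exists_basis_completeSpan (E := E) x
  choose hhol φ hφ using hv
  let b : Fin n → E := fun i => v i x
  obtain ⟨W, hW⟩ := (Submodule.span ℂ (range b)).exists_isCompl
  obtain ⟨ψ, hψ, hψ0, hleft, hright⟩ := exists_inverse_flowBox hhol hφ x W (b := b)
    (fun i => rfl) hli hW
  set G := flowBox φ (List.finRange n) x W with hG
  have hGd := contMDiffAt_flowBox hhol hφ (List.finRange n) x W
  have hG0 : G 0 = x := flowBox_zero hφ _ x W
  -- W varies with x; taking values in E gives all charts a common target.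
  let S : (Fin n → ℂ) × W →L[ℂ] E := W.subtypeL ∘L ContinuousLinearMap.snd ℂ _ _
  let s : X → E := fun y => S (ψ y)
  have hP : ∀ᶠ p in 𝓝 (0 : (Fin n → ℂ) × W), MDifferentiableAt 𝓘(ℂ, E) 𝓘(ℂ, E) s (G p) ∧
      ∀ w ∈ completeSpan E (G p), mfderiv 𝓘(ℂ, E) 𝓘(ℂ, E) s (G p) w = 0 := by
    have h1 := (contMDiffAt_iff_contMDiffAt_nhds (by simp)).1 hGd
    have h2 := (contMDiffAt_iff_contMDiffAt_nhds (by simp)).1 hψ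
    rw [← hG0] at h2
    filter_upwards [h1, hGd.continuousAt.eventually h2, eventually_eventually_nhds.2 hleft]
      with p hp1 hp2 hp3
    have hGp : HasMFDerivAt 𝓘(ℂ, (Fin n → ℂ) × W) 𝓘(ℂ, E) G p _ :=
      (hp1.mdifferentiableAt (by simp)).hasMFDerivAt
    have hψp := (hp2.mdifferentiableAt (by simp)).hasMFDerivAt
    have hsp := HasMFDerivAt.comp (G p) (S.hasMFDerivAt (x := ψ (G p))) hψp
    refine ⟨hsp.mdifferentiableAt, fun w hw => ?_⟩
    let A : (Fin n → ℂ) × W →L[ℂ] E := mfderiv 𝓘(ℂ, (Fin n → ℂ) × W) 𝓘(ℂ, E) G p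
    let B : E →L[ℂ] (Fin n → ℂ) × W := mfderiv 𝓘(ℂ, E) 𝓘(ℂ, (Fin n → ℂ) × W) ψ (G p)
    have hBA : ∀ q, B (A q) = q := by
      have h3 : HasFDerivAt (ψ ∘ G) (B ∘L A) p := (HasMFDerivAt.comp p hψp hGp).hasFDerivAt
      have h4 : HasFDerivAt (ψ ∘ G) (.id ℂ ((Fin n → ℂ) × W)) p :=
        (hasFDerivAt_id p).congr_of_eventuallyEq hp3
      exact fun q => DFunLike.congr_fun (h3.unique h4) q
    have hA : ∀ τ, A (τ, 0) ∈ completeSpan E (G p) := by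
      intro τ
      have h3 : HasMFDerivAt 𝓘(ℂ, Fin n → ℂ) 𝓘(ℂ, (Fin n → ℂ) × W)
          (fun t : Fin n → ℂ => (t, p.2)) p.1 (.inl ℂ (Fin n → ℂ) W) :=
        (hasFDerivAt_prodMk_left p.1 p.2).hasMFDerivAt
      have h4 := HasMFDerivAt.comp (f := fun t : Fin n → ℂ => (t, p.2)) p.1 hGp h3
      have h5 := mfderiv_multiFlow_mem hhol hφ (List.finRange n) (chartSlice x W p.2) p.1 τ
      have h6 := DFunLike.congr_fun h4.mfderiv τ
      exact (congrArg (· ∈ completeSpan E (G p)) h6).mp h5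
    let D : Submodule ℂ E := completeSpan E (G p)
    -- Constant rank enters here: at G p the n flow directions exhaust the distribution, so its
    -- vectors have no W-component.
    have hD : Module.finrank ℂ D ≤ Module.finrank ℂ (Fin n → ℂ) := by
      rw [Module.finrank_fin_fun]
      exact ((hr (G p)).trans ((hr x).symm.trans hn.symm)).le
    have hz : (B w).2 = 0 := LinearMap.snd_eq_zero_of_leftInverse (A := A.toLinearMap)
      (B := B.toLinearMap) hBA (D := D) hA hD hw
    refine (DFunLike.congr_fun hsp.mfderiv w).trans ?_
    change ((B w).2 : E) = 0
    rw [hz, ZeroMemClass.coe_zero]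
  have hQ : ∀ᶠ y in 𝓝 x, G (ψ y) = y ∧ MDifferentiableAt 𝓘(ℂ, E) 𝓘(ℂ, E) s y ∧
      ∀ w ∈ completeSpan E y, mfderiv 𝓘(ℂ, E) 𝓘(ℂ, E) s y w = 0 := by
    have h1 : Tendsto ψ (𝓝 x) (𝓝 0) := hψ0 ▸ hψ.continuousAt.tendsto
    filter_upwards [hright, h1.eventually hP] with y hy1 hy2
    rw [hy1] at hy2
    exact ⟨hy1, hy2⟩
  obtain ⟨U, hUsub, hUo, hxU⟩ := eventually_nhds_iff.1 hQ
  have hslice : ContinuousAt (chartSlice x W) 0 := (contMDiffAt_chartSlice x W).continuousAt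
  refine ⟨U, s, ⟨hUo, fun y hy => (hUsub y hy).2.1, fun y hy => (hUsub y hy).2.2, ?_⟩, hxU, ?_⟩
  · intro c
    -- The coordinate takes values in W, so for c outside W the fibre is empty and any tangent map
    -- serves.
    by_cases hc : c ∈ W
    · refine ⟨n, fun t => multiFlow φ (List.finRange n) t (chartSlice x W ⟨c, hc⟩),
        fun t => ⟨(contMDiff_multiFlow_left hhol hφ _ _).mdifferentiableAt (by simp),
          mfderiv_multiFlow_mem hhol hφ _ _ t⟩, fun y hy hyc => ⟨(ψ y).1, ?_⟩⟩
      have h : (ψ y).2 = ⟨c, hc⟩ := Subtype.ext hyc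
      have hy' := (hUsub y hy).1
      rw [hG, flowBox, h] at hy'
      exact hy'
    · refine ⟨n, fun t => multiFlow φ (List.finRange n) t x,
        fun t => ⟨(contMDiff_multiFlow_left hhol hφ _ _).mdifferentiableAt (by simp),
          mfderiv_multiFlow_mem hhol hφ _ _ t⟩, fun y _ hyc => (hc ?_).elim⟩
      rw [← hyc]
      exact (ψ y).2.2
  · intro hlt hcount
    have hWnt : Nontrivial W := by
      rw [Submodule.nontrivial_iff_ne_bot]
      rintro rfl
      have h1 : Submodule.span ℂ (range b) = ⊤ := by simpa using hW.sup_eq_top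
      have h2 := finrank_span_eq_card (R := ℂ) (b := b) hli
      rw [h1, finrank_top, Fintype.card_fin, hn, hr x] at h2
      omega
    have hpre : {w : W | (w : E) ∈ s '' U}.Countable :=
      hcount.preimage Subtype.val_injective
    -- On the slice the transversal coordinate is w itself, so its values fill a neighbourhood of 0
    -- in the nonzero space W, which no countable set does.
    have hmem : {w : W | (w : E) ∈ s '' U} ∈ 𝓝 0 := by
      have h1 : Tendsto (fun w : W => ((0 : Fin n → ℂ), w)) (𝓝 0) (𝓝 0) :=
        (by fun_prop : Continuous fun w : W => ((0 : Fin n → ℂ), w)).tendsto 0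
      have h2 : ∀ᶠ w in 𝓝 (0 : W), chartSlice x W w ∈ U :=
        hslice.eventually (by rw [chartSlice_zero]; exact hUo.mem_nhds hxU)
      filter_upwards [h1.eventually hleft, h2] with w hw1 hw2
      refine ⟨_, hw2, ?_⟩
      have h3 : G (0, w) = chartSlice x W w := multiFlow_zero hφ _ _
      change S (ψ (chartSlice x W w)) = w
      rw [← h3, hw1]
      rfl
    obtain ⟨w, hw, hw'⟩ := (hpre.dense_compl ℂ).inter_nhds_nonempty hmem
    exact hw hw'

/-- If the special automorphisms act transitively, the manifold is holomorphically flexible. -/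
theorem isHolomorphicallyFlexible_of_isPretransitive [SecondCountableTopology X]
    (hX : MulAction.IsPretransitive (SAutHol E X) X) : IsHolomorphicallyFlexible E X := by
  intro x₀
  have hr : ∀ y : X, Module.finrank ℂ (completeSpan E y) =
      Module.finrank ℂ (completeSpan E x₀) := by
    intro y
    obtain ⟨g, rfl⟩ := hX.exists_smul_eq x₀ y
    exact AutHol.finrank_completeSpan_smul (g : AutHol E X) x₀
  choose U s hU hx hcount using exists_isFoliatedChart hr
  have : FiniteDimensional ℂ (TangentSpace 𝓘(ℂ, E) x₀) := inferInstanceAs (FiniteDimensional ℂ E)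
  refine Submodule.eq_top_of_finrank_eq ?_
  refine le_antisymm (Submodule.finrank_le _) (not_lt.1 fun hlt => ?_)
  exact hcount x₀ hlt (IsFoliatedChart.countable_image_of_isPretransitive hU hx x₀)

end Foliation

theorem mainTheorem4
    {E : Type*} [NormedAddCommGroup E] [NormedSpace ℂ E] [FiniteDimensional ℂ E]
    {X : Type*} [TopologicalSpace X] [T2Space X] [SecondCountableTopology X] [ConnectedSpace X]
    [ChartedSpace E X] [IsManifold 𝓘(ℂ, E) ω X] :
    (MulAction.IsPretransitive (SAutHol E X) X ↔ IsHolomorphicallyFlexible E X) ∧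
      (IsHolomorphicallyFlexible E X → MulAction.IsPretransitive (AutHol E X) X) := by
  refine ⟨⟨isHolomorphicallyFlexible_of_isPretransitive, fun hX => hX.isPretransitive_SAutHol⟩,
    fun hX => ⟨fun x y => ?_⟩⟩
  obtain ⟨g, hg⟩ := hX.isPretransitive_SAutHol.exists_smul_eq x y
  exact ⟨g, hg⟩
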